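/- Throughout, fix a free ultrafilter $\mathcal U$ on $\mathbb N$. For a $C^*$-algebra $A$ let $T(A)$ be the set of its tracial states with the weak* topology, $\|a\|_{2,T(A)}=\sup_{\tau\in T(A)}\tau(a^*a)^{1/2}$, and $$A^{\mathcal U}=\ell^\infty(A)/\{(a_n)_n:\lim_{n\to\mathcal U}\|a_n\|_{2,T(A)}=0\};$$ elements of $A$ are viewed in $A^{\mathcal U}$ as classes of constant sequences. Let $T_{\mathcal U}(A)$ be the set of limit traces on $A^{\mathcal U}$, i.e. the functionals $[(a_n)_n]\mapsto\lim_{n\to\mathcal U}\tau_n(a_n)$ with $\tau_n\in T(A)$, and $\|x\|_{2,T_{\mathcal U}(A)}=\sup_{\tau\in T_{\mathcal U}(A)}\tau(x^*x)^{1/2}$. For a nonzero $C^*$-subalgebra $D\subseteq A$ let $\kappa(D^{\mathcal U})\subseteq A^{\mathcal U}$ be the set of elements represented by bounded sequences in $D$. Let $A$ be separable with $T(A)$ nonempty and compact. One says that $(D\subseteq A)$ has *weak CPoU* if $A^{\mathcal U}$ is unital with $1_{A^{\mathcal U}}\in\kappa(D^{\mathcal U})$, and for every $\|\cdot\|_{2,T_{\mathcal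 U}(A)}$-separable subset $S\subseteq A^{\mathcal U}$, every $k\ge 1$, all positive $a_1,\dots,a_k\in D$ and every $\delta>0$ with $$\sup_{\tau\in T(A)}\min\{\tau(a_1),\dots,\tau(a_k)\}<\delta,$$ and every positive contraction $q\in\kappa(D^{\mathcal U})\cap A'$ with $\tau(q)>0$ for all $\tau\in T_{\mathcal U}(A)$, there are positive contractions $e_1,\dots,e_k\in\kappa(D^{\mathcal U})\cap S'$ such that $$\sum_{i=1}^k e_i=1_{A^{\mathcal U}}\quad\text{and}\quad \tau(a_ie_iq)\le\delta\,\tau(e_iq)\qquad(\tau\in T_{\mathcal U}(A),\ i=1,\dots,k).$$ **Theorem.** Let $X$ be a nonempty compact metric space and let $\alpha\colon G\curvearrowright X$ be an action by homeomorphisms of a countable discrete amenable group $G$. Then $C(X)\rtimes_\alpha G$ is separable, $T(C(X)\rtimes_\alpha G)$ is nonempty and compact, and the sub-$C^*$-algebra $(C(X)\subseteq C(X)\rtimes_\alpha G)$ has weak CPoU. -/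

import Mathlib

open Filter Topology
open scoped ENNReal ComplexOrder Pointwise symmDiff

noncomputable section

/-! ### Amenable groups and the crossed product `C(X) ⋊ G` -/

/-- Amenability of a discrete group, as the Følner condition: for every finite `K ⊆ G` and every
`ε > 0` there is a nonempty finite `F ⊆ G` with `|gF ∆ F| ≤ ε |F|` for all `g ∈ K`. -/
def IsAmenableGroup (G : Type*) [Group G] : Prop :=
  ∀ (K : Finset G) (ε : ℝ), 0 < ε → ∃ F : Finset G, F.Nonempty ∧
    ∀ g ∈ K, (((g • (F : Set G)) ∆ (F : Set G)).ncard : ℝ) ≤ ε * (F.card : ℝ)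

section CrossedProduct

universe u v

variable (G : Type u) (X : Type v) [Group G] [TopologicalSpace X] [CompactSpace X]
  [MulAction G X] [ContinuousConstSMul G X]

variable {G X} in
/-- The action of `G` on `C(X)` induced by an action on `X`: `(α_g f)(x) = f(g⁻¹ x)`. -/
def translateFun (g : G) (f : C(X, ℂ)) : C(X, ℂ) :=
  f.comp ⟨fun x => g⁻¹ • x, continuous_const_smul _⟩

/-- A covariant representation of `(C(X), G, α)` on a Hilbert space: a unital `*`-representation of
`C(X)` and a unitary representation of `G` with `u_g π(f) u_g^* = π(α_g f)`. -/
structure CovariantRep where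
  /-- the Hilbert space -/
  H : Type (max u v)
  [normedAddCommGroup : NormedAddCommGroup H]
  [innerProductSpace : InnerProductSpace ℂ H]
  [completeSpace : CompleteSpace H]
  /-- the representation of `C(X)` -/
  π : C(X, ℂ) →⋆ₐ[ℂ] (H →L[ℂ] H)
  /-- the representation of `G` -/
  U : G →* unitary (H →L[ℂ] H)
  covariant : ∀ (g : G) (f : C(X, ℂ)),
    (U g : H →L[ℂ] H) * π f * star (U g : H →L[ℂ] H) = π (translateFun g f)

attribute [instance] CovariantRep.normedAddCommGroup CovariantRep.innerProductSpace
  CovariantRep.completeSpace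

/-- The `ℓ^∞`-product of the algebras `B(H)` over all covariant representations. The underlying
Hilbert spaces may be arbitrarily large up to the cardinality of the universe of `G` and `X`,
which includes all cyclic covariant representations. -/
abbrev CovariantProd : Type _ := lp (fun ρ : CovariantRep G X => ρ.H →L[ℂ] ρ.H) ∞

/-- The universal representation of `C(X)`: `f ↦ (π_ρ(f))_ρ`. -/
def univFun : C(X, ℂ) →⋆ₙₐ[ℂ] CovariantProd G X where
  toFun f := ⟨fun ρ => ρ.π f, memℓp_infty ⟨‖f‖, by
    rintro _ ⟨ρ, rfl⟩
    exact NonUnitalStarAlgHom.norm_apply_le ρ.π f⟩⟩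
  map_smul' c f := by ext1; funext ρ; exact map_smul ρ.π c f
  map_zero' := by ext1; funext ρ; exact map_zero ρ.π
  map_add' f g := by ext1; funext ρ; exact map_add ρ.π f g
  map_mul' f g := by ext1; funext ρ; exact map_mul ρ.π f g
  map_star' f := by ext1; funext ρ; exact map_star ρ.π f

/-- The universal unitaries: `u_g = (U_ρ(g))_ρ`. -/
def univUnitary (g : G) : CovariantProd G X :=
  ⟨fun ρ => (ρ.U g : ρ.H →L[ℂ] ρ.H), memℓp_infty ⟨1, by
    rintro _ ⟨ρ, rfl⟩
    have h := CStarRing.norm_coe_unitary_mul (ρ.U g) (1 : ρ.H →L[ℂ] ρ.H)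
    rw [mul_one] at h
    exact h.le.trans ContinuousLinearMap.norm_id_le⟩⟩

/-- The (full) crossed product `C(X) ⋊ G`: the C*-algebra generated by the images of `C(X)` and
of `G` in the direct sum of all covariant representations. -/
def crossedProduct : NonUnitalStarSubalgebra ℂ (CovariantProd G X) :=
  (NonUnitalStarAlgebra.adjoin ℂ
    (Set.range (univFun G X) ∪ Set.range (univUnitary G X))).topologicalClosure

/-- `C(X) ⋊ G` as a type. -/
abbrev CrossedProduct : Type _ := crossedProduct G X

instance crossedProduct_isClosed : IsClosed (crossedProduct G X : Set (CovariantProd G X)) :=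
  NonUnitalStarSubalgebra.isClosed_topologicalClosure _

/-- The canonical `*`-homomorphism `C(X) → C(X) ⋊ G`. -/
def crossedProductFun : C(X, ℂ) →⋆ₙₐ[ℂ] CrossedProduct G X :=
  NonUnitalStarAlgHom.codRestrict (univFun G X) (crossedProduct G X) fun f =>
    NonUnitalStarSubalgebra.le_topologicalClosure _
      (NonUnitalStarAlgebra.subset_adjoin ℂ _ (Or.inl ⟨f, rfl⟩))

/-- The copy of `C(X)` inside `C(X) ⋊ G`. -/
def crossedProductDiagonal : NonUnitalStarSubalgebra ℂ (CrossedProduct G X) :=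
  NonUnitalStarAlgHom.range (crossedProductFun G X)

end CrossedProduct

/-! ### Traces, the uniform 2-norm and the uniform tracial ultrapower -/

/-- An element of a `*`-algebra of the form `y^* y`; in a C*-algebra these are exactly the positive
elements. -/
def IsStarPositive {R : Type*} [Mul R] [Star R] (x : R) : Prop := ∃ y : R, x = star y * y

/-- The uniform 2-(semi)norm `‖a‖_{2,T} = sup_{τ ∈ T} τ(a^* a)^{1/2}` for a set `T` of functionals. -/
def twoNorm {F R : Type*} [FunLike F R ℂ] [Mul R] [Star R] (T : Set F) (a : R) : ℝ :=
  ⨆ τ : T, Real.sqrt ((τ : F) (star a * a)).re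

section Ultrapower

variable (A : Type*) [NonUnitalCStarAlgebra A]

/-- The trace space `T(A)`: the tracial states of `A`, with the weak* topology. -/
def traceSpace : Set (WeakDual ℂ A) :=
  {τ | (∀ a : A, 0 ≤ τ (star a * a)) ∧ ‖WeakDual.toStrongDual τ‖ = 1 ∧
    ∀ a b : A, τ (a * b) = τ (b * a)}

/-- `ℓ^∞(A)`, the bounded sequences in `A`. -/
abbrev BddSeq : Type _ := lp (fun _ : ℕ => A) ∞

variable {A}

lemma traceSpace_bdd (a : A) :
    BddAbove (Set.range fun τ : traceSpace A => Real.sqrt ((τ : WeakDual ℂ A) (star a * a)).re) := by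
  refine ⟨‖a‖, ?_⟩
  rintro _ ⟨⟨τ, hτ⟩, rfl⟩
  refine Real.sqrt_le_iff.2 ⟨norm_nonneg _, ?_⟩
  have h1 : ‖τ (star a * a)‖ ≤ ‖WeakDual.toStrongDual τ‖ * ‖star a * a‖ :=
    (WeakDual.toStrongDual τ).le_opNorm _
  rw [hτ.2.1, one_mul, CStarRing.norm_star_mul_self] at h1
  calc (τ (star a * a)).re ≤ ‖τ (star a * a)‖ := Complex.re_le_norm _
    _ ≤ ‖a‖ ^ 2 := by rw [sq]; exact h1

lemma sqrt_le_twoNorm {τ : WeakDual ℂ A} (hτ : τ ∈ traceSpace A) (a : A) :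
    Real.sqrt (τ (star a * a)).re ≤ twoNorm (traceSpace A) a :=
  le_ciSup (traceSpace_bdd a) ⟨τ, hτ⟩

lemma twoNorm_nonneg (a : A) : 0 ≤ twoNorm (traceSpace A) a :=
  Real.iSup_nonneg fun _ => Real.sqrt_nonneg _

lemma re_le_twoNorm_sq {τ : WeakDual ℂ A} (hτ : τ ∈ traceSpace A) (a : A) :
    (τ (star a * a)).re ≤ twoNorm (traceSpace A) a ^ 2 :=
  (Real.sqrt_le_left (twoNorm_nonneg a)).1 (sqrt_le_twoNorm hτ a)

lemma twoNorm_le {a : A} {c : ℝ} (hc : 0 ≤ c)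
    (h : ∀ τ ∈ traceSpace A, (τ (star a * a)).re ≤ c ^ 2) : twoNorm (traceSpace A) a ≤ c :=
  Real.iSup_le (fun τ => Real.sqrt_le_iff.2 ⟨hc, h τ τ.2⟩) hc

lemma twoNorm_star (a : A) : twoNorm (traceSpace A) (star a) = twoNorm (traceSpace A) a := by
  unfold twoNorm
  congr 1
  funext τ
  rw [star_star, τ.2.2.2]

lemma twoNorm_smul_le (c : ℂ) (a : A) :
    twoNorm (traceSpace A) (c • a) ≤ ‖c‖ * twoNorm (traceSpace A) a := by
  refine twoNorm_le (mul_nonneg (norm_nonneg _) (twoNorm_nonneg a)) fun τ hτ => ?_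
  have h1 : star (c • a) * (c • a) = ((‖c‖ ^ 2 : ℝ) : ℂ) • (star a * a) := by
    rw [star_smul, smul_mul_smul_comm, Complex.star_def, ← Complex.normSq_eq_conj_mul_self,
      Complex.normSq_eq_norm_sq]
  rw [h1, map_smul, smul_eq_mul, Complex.re_ofReal_mul, mul_pow]
  exact mul_le_mul_of_nonneg_left (re_le_twoNorm_sq hτ a) (sq_nonneg _)

lemma twoNorm_add_le (a b : A) :
    twoNorm (traceSpace A) (a + b) ≤
      2 * (twoNorm (traceSpace A) a + twoNorm (traceSpace A) b) := by
  have ha := twoNorm_nonneg a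
  have hb := twoNorm_nonneg b
  refine twoNorm_le (by positivity) fun τ hτ => ?_
  have h1 := re_le_twoNorm_sq hτ a
  have h2 := re_le_twoNorm_sq hτ b
  have h3 := (Complex.le_def.1 (hτ.1 (a - b))).1
  have h4 : star (a + b) * (a + b) + star (a - b) * (a - b)
      = (star a * a + star a * a) + (star b * b + star b * b) := by
    simp only [star_add, star_sub]; noncomm_ring
  have h5 := congrArg (fun x => (τ x).re) h4
  simp only [map_add, Complex.add_re] at h5
  simp only [Complex.zero_re] at h3
  nlinarith [mul_nonneg ha hb]

lemma twoNorm_mul_le (a b : A) :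
    twoNorm (traceSpace A) (a * b) ≤ ‖a‖ * twoNorm (traceSpace A) b := by
  let := CStarAlgebra.spectralOrder A
  let := CStarAlgebra.spectralOrderedRing A
  refine twoNorm_le (mul_nonneg (norm_nonneg _) (twoNorm_nonneg b)) fun τ hτ => ?_
  have h1 : star b * (star a * a) * b ≤ ‖star a * a‖ • (star b * b) :=
    CStarAlgebra.star_left_conjugate_le_norm_smul (IsSelfAdjoint.star_mul_self a)
  obtain ⟨y, hy⟩ := CStarAlgebra.nonneg_iff_eq_star_mul_self.1 (sub_nonneg.2 h1)
  have h2 := (Complex.le_def.1 (hτ.1 y)).1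
  have h3 : ‖star a * a‖ • (star b * b) = ((‖a‖ ^ 2 : ℝ) : ℂ) • (star b * b) := by
    rw [CStarRing.norm_star_mul_self, ← sq]
    exact (Complex.coe_smul _ _).symm
  rw [← hy, h3, map_sub, map_smul, smul_eq_mul, Complex.sub_re, Complex.re_ofReal_mul,
    Complex.zero_re] at h2
  have h4 : star (a * b) * (a * b) = star b * (star a * a) * b := by
    rw [star_mul]; noncomm_ring
  rw [h4, mul_pow]
  have h5 := mul_le_mul_of_nonneg_left (re_le_twoNorm_sq hτ b) (sq_nonneg ‖a‖)
  linarith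

lemma twoNorm_mul_le' (a b : A) :
    twoNorm (traceSpace A) (a * b) ≤ twoNorm (traceSpace A) a * ‖b‖ := by
  rw [← twoNorm_star, star_mul, mul_comm]
  refine (twoNorm_mul_le _ _).trans (le_of_eq ?_)
  rw [norm_star, twoNorm_star]

variable (A) (𝓤 : Ultrafilter ℕ)

/-- The trace-kernel ideal: bounded sequences with `lim_{n → 𝓤} ‖a_n‖_{2,T(A)} = 0`. -/
def traceKernel : Submodule ℂ (BddSeq A) where
  carrier := {a | Tendsto (fun n => twoNorm (traceSpace A) (a n)) 𝓤 (𝓝 0)}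
  zero_mem' := by
    have h : twoNorm (traceSpace A) (0 : A) = 0 := by simp [twoNorm]
    change Tendsto (fun _ => twoNorm (traceSpace A) (0 : A)) _ _
    rw [h]
    exact tendsto_const_nhds
  add_mem' {a b} ha hb := by
    refine squeeze_zero (fun _ => twoNorm_nonneg _) (fun n => twoNorm_add_le (a n) (b n)) ?_
    simpa using (Tendsto.add ha hb).const_mul 2
  smul_mem' c a ha := by
    refine squeeze_zero (fun _ => twoNorm_nonneg _) (fun n => twoNorm_smul_le c (a n)) ?_
    simpa using Tendsto.const_mul ‖c‖ ha

variable {A 𝓤}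

lemma traceKernel_mul_left (a : BddSeq A) {b : BddSeq A} (hb : b ∈ traceKernel A 𝓤) :
    a * b ∈ traceKernel A 𝓤 := by
  refine squeeze_zero (fun _ => twoNorm_nonneg _) (fun n => (twoNorm_mul_le (a n) (b n)).trans
    (mul_le_mul_of_nonneg_right (lp.norm_apply_le_norm ENNReal.top_ne_zero a n)
      (twoNorm_nonneg _))) ?_
  simpa using Tendsto.const_mul ‖a‖ hb

lemma traceKernel_mul_right {a : BddSeq A} (b : BddSeq A) (ha : a ∈ traceKernel A 𝓤) :
    a * b ∈ traceKernel A 𝓤 := by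
  refine squeeze_zero (fun _ => twoNorm_nonneg _) (fun n => (twoNorm_mul_le' (a n) (b n)).trans
    (mul_le_mul_of_nonneg_left (lp.norm_apply_le_norm ENNReal.top_ne_zero b n)
      (twoNorm_nonneg _))) ?_
  simpa using Tendsto.mul_const ‖b‖ ha

lemma traceKernel_star {a : BddSeq A} (ha : a ∈ traceKernel A 𝓤) :
    star a ∈ traceKernel A 𝓤 :=
  Tendsto.congr (fun n => (twoNorm_star (a n)).symm) ha

variable (A 𝓤)

/-- The uniform tracial ultrapower `A^𝓤`, the quotient of `ℓ^∞(A)` by the trace-kernel ideal; as a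
quotient it carries the vector space structure and the quotient norm, which is its C*-norm. -/
abbrev TracialUltrapower : Type _ := BddSeq A ⧸ traceKernel A 𝓤

variable {A}

/-- The class in `A^𝓤` of a bounded sequence. -/
def toUltrapower (a : BddSeq A) : TracialUltrapower A 𝓤 := Submodule.Quotient.mk a

instance : Mul (TracialUltrapower A 𝓤) where
  mul := Quotient.map₂ (· * ·) fun a a' ha b b' hb => by
    replace ha := (Submodule.quotientRel_def _).1 ha
    replace hb := (Submodule.quotientRel_def _).1 hb
    refine (Submodule.quotientRel_def _).2 ?_
    have h : a * b - a' * b' = (a - a') * b + a' * (b - b') := by noncomm_ring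
    rw [h]
    exact add_mem (traceKernel_mul_right b ha) (traceKernel_mul_left a' hb)

instance : Star (TracialUltrapower A 𝓤) where
  star := Quotient.map star fun a b h => by
    replace h := (Submodule.quotientRel_def _).1 h
    refine (Submodule.quotientRel_def _).2 ?_
    rw [← star_sub]
    exact traceKernel_star h

lemma toUltrapower_surjective : Function.Surjective (toUltrapower (A := A) 𝓤) :=
  Submodule.Quotient.mk_surjective _

lemma toUltrapower_mul (a b : BddSeq A) :
    toUltrapower 𝓤 (a * b) = toUltrapower 𝓤 a * toUltrapower 𝓤 b := rfl

lemma toUltrapower_star (a : BddSeq A) : toUltrapower 𝓤 (star a) = star (toUltrapower 𝓤 a) := rfl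

lemma toUltrapower_add (a b : BddSeq A) :
    toUltrapower 𝓤 (a + b) = toUltrapower 𝓤 a + toUltrapower 𝓤 b := rfl

/-- `A^𝓤` is a ring under the operations induced from `ℓ^∞(A)`. -/
instance : NonUnitalRing (TracialUltrapower A 𝓤) where
  left_distrib x y z := by
    obtain ⟨a, rfl⟩ := toUltrapower_surjective 𝓤 x
    obtain ⟨b, rfl⟩ := toUltrapower_surjective 𝓤 y
    obtain ⟨c, rfl⟩ := toUltrapower_surjective 𝓤 z
    exact congrArg (toUltrapower 𝓤) (mul_add a b c)
  right_distrib x y z := by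
    obtain ⟨a, rfl⟩ := toUltrapower_surjective 𝓤 x
    obtain ⟨b, rfl⟩ := toUltrapower_surjective 𝓤 y
    obtain ⟨c, rfl⟩ := toUltrapower_surjective 𝓤 z
    exact congrArg (toUltrapower 𝓤) (add_mul a b c)
  zero_mul x := by
    obtain ⟨a, rfl⟩ := toUltrapower_surjective 𝓤 x
    exact congrArg (toUltrapower 𝓤) (zero_mul a)
  mul_zero x := by
    obtain ⟨a, rfl⟩ := toUltrapower_surjective 𝓤 x
    exact congrArg (toUltrapower 𝓤) (mul_zero a)
  mul_assoc x y z := by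
    obtain ⟨a, rfl⟩ := toUltrapower_surjective 𝓤 x
    obtain ⟨b, rfl⟩ := toUltrapower_surjective 𝓤 y
    obtain ⟨c, rfl⟩ := toUltrapower_surjective 𝓤 z
    exact congrArg (toUltrapower 𝓤) (mul_assoc a b c)

instance : StarRing (TracialUltrapower A 𝓤) where
  star_involutive x := by
    obtain ⟨a, rfl⟩ := toUltrapower_surjective 𝓤 x
    exact congrArg (toUltrapower 𝓤) (star_star a)
  star_mul x y := by
    obtain ⟨a, rfl⟩ := toUltrapower_surjective 𝓤 x
    obtain ⟨b, rfl⟩ := toUltrapower_surjective 𝓤 y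
    exact congrArg (toUltrapower 𝓤) (star_mul a b)
  star_add x y := by
    obtain ⟨a, rfl⟩ := toUltrapower_surjective 𝓤 x
    obtain ⟨b, rfl⟩ := toUltrapower_surjective 𝓤 y
    exact congrArg (toUltrapower 𝓤) (star_add a b)

/-- The class in `A^𝓤` of the constant sequence `a`. -/
def constUltrapower (a : A) : TracialUltrapower A 𝓤 :=
  toUltrapower 𝓤 ⟨fun _ => a, memℓp_infty ⟨‖a‖, by rintro _ ⟨_, rfl⟩; exact le_rfl⟩⟩

variable (A) in
/-- The set `T_𝓤(A)` of limit traces: the functionals on `A^𝓤` induced by sequences `(τ_n)` of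
traces on `A`, i.e. `[(a_n)] ↦ lim_{n → 𝓤} τ_n(a_n)`. -/
def limitTraces : Set (TracialUltrapower A 𝓤 →ₗ[ℂ] ℂ) :=
  {φ | ∃ τ : ℕ → WeakDual ℂ A, (∀ n, τ n ∈ traceSpace A) ∧
    ∀ a : BddSeq A, Tendsto (fun n => τ n (a n)) 𝓤 (𝓝 (φ (toUltrapower 𝓤 a)))}

/-- `S ⊆ A^𝓤` is separable for `‖·‖_{2,T_𝓤(A)}`. -/
def IsTwoNormSeparable (S : Set (TracialUltrapower A 𝓤)) : Prop :=
  ∃ C ⊆ S, C.Countable ∧ ∀ s ∈ S, ∀ ε > 0, ∃ c ∈ C, twoNorm (limitTraces A 𝓤) (s - c) < ε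

/-- `κ(D^𝓤)`: the elements of `A^𝓤` which are represented by bounded sequences in `D`. -/
def subUltrapower (D : NonUnitalStarSubalgebra ℂ A) : Set (TracialUltrapower A 𝓤) :=
  {x | ∃ d : BddSeq A, (∀ n, d n ∈ D) ∧ toUltrapower 𝓤 d = x}

/-- A positive contraction of the C*-algebra `A^𝓤`. -/
def IsPositiveContraction (x : TracialUltrapower A 𝓤) : Prop := IsStarPositive x ∧ ‖x‖ ≤ 1

/-- Weak CPoU for a sub-C*-algebra `D ⊆ A` (with respect to the ultrafilter `𝓤`). The first five
fields are the standing requirements: `D` is a nonzero C*-subalgebra of `A`, `A` is separable, and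
`T(A)` is nonempty and (weak*) compact. In the last one, `one` is the unit of `A^𝓤`. -/
structure HasWeakCPoU (D : NonUnitalStarSubalgebra ℂ A) : Prop where
  isClosed : IsClosed (D : Set A)
  ne_bot : D ≠ ⊥
  separable : TopologicalSpace.SeparableSpace A
  nonempty_traceSpace : (traceSpace A).Nonempty
  isCompact_traceSpace : IsCompact (traceSpace A)
  exists_partition : ∃ one ∈ subUltrapower 𝓤 D, (∀ x, one * x = x ∧ x * one = x) ∧
    ∀ S : Set (TracialUltrapower A 𝓤), IsTwoNormSeparable 𝓤 S →
    ∀ (k : ℕ), 0 < k → ∀ a : Fin k → A, (∀ i, a i ∈ D ∧ IsStarPositive (a i)) →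
    ∀ δ : ℝ, 0 < δ →
      (⨆ τ : traceSpace A, ⨅ i, ((τ : WeakDual ℂ A) (a i)).re) < δ →
    ∀ q ∈ subUltrapower 𝓤 D, IsPositiveContraction 𝓤 q →
      (∀ b : A, Commute q (constUltrapower 𝓤 b)) →
      (∀ τ ∈ limitTraces A 𝓤, 0 < (τ q).re) →
    ∃ e : Fin k → TracialUltrapower A 𝓤,
      (∀ i, e i ∈ subUltrapower 𝓤 D ∧ IsPositiveContraction 𝓤 (e i) ∧
        ∀ s ∈ S, Commute (e i) s) ∧
      ∑ i, e i = one ∧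
      ∀ τ ∈ limitTraces A 𝓤, ∀ i,
        (τ (constUltrapower 𝓤 (a i) * e i * q)).re ≤ δ * (τ (e i * q)).re

end Ultrapower

end

/-! The heart of the proof is a statement about functions on `X`. Suppose `f_1, …, f_k` are real
continuous functions such that every trace is negative on some `f_i`. Limits of orbit averages over
Følner sets are traces, so a limiting argument gives a very invariant finite set `F` such that at
every `x` one of the sums `B_i(x) = ∑_{g ∈ F} f_i(g x)` is negative (`exists_folner_sum_neg`). The
negative parts `N_i` of the `B_i` then have a strictly positive sum `S`, the functions `h_i = N_i /
S` form a partition of unity, and so do their averages `e_i(x) = |F|⁻¹ ∑_{g ∈ F} h_i(g⁻¹ x)`. The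
`e_i` are almost invariant because `F` is Følner. Traces are invariant on `C(X)`, so the averaging
can be moved onto `f_i`: `τ(f_i e_i) = |F|⁻¹ τ(B_i h_i) = -|F|⁻¹ τ(N_i² / S) ≤ 0`
(`exists_partition`).

For weak CPoU this is applied to `f_i = (a_i - δ) r_n`, where the real functions `r_n` represent
`q`. Since `q` is central relative to `A`, each limit trace `φ` yields a genuine trace `φ(· q) /
φ(q)` on `A` (`exists_traceSpace_of_central`), which is below `δ` on some `a_i`. Hence the
negativity hypothesis holds for `𝓤`-most `n` (`eventually_exists_neg`).

Almost invariant functions almost commute with any given element of the crossed product, since `h f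
u_g - f u_g h = f (h - α_g h) u_g` (`exists_norm_commutator_le`). A diagonal choice of the
partitions therefore commutes with a countable dense subset of `S`, and so with `S`. -/

noncomputable section

/-! ### The regular covariant representations -/

section RegularRepresentation

/-- The Hilbert space `ℓ²(ι)`. -/
abbrev EllTwo (ι : Type*) : Type _ := lp (fun _ : ι => ℂ) 2

lemma memℓp_two_iff {ι : Type*} {f : ι → ℂ} : Memℓp f 2 ↔ Summable fun i => ‖f i‖ ^ 2 := by
  rw [memℓp_gen_iff (by norm_num)]
  simp

lemma EllTwo.summable_norm_sq {ι : Type*} (ξ : EllTwo ι) : Summable fun i => ‖ξ i‖ ^ 2 :=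
  memℓp_two_iff.1 (lp.memℓp ξ)

lemma EllTwo.norm_sq_eq {ι : Type*} (ξ : EllTwo ι) : ‖ξ‖ ^ 2 = ∑' i, ‖ξ i‖ ^ 2 := by
  have h := lp.norm_rpow_eq_tsum (p := 2) (by norm_num) ξ
  simpa using h

/-- Evaluation of continuous functions along `φ : ι → X`, as multiplication operators on `ℓ²(ι)`. -/
def pullbackOp {ι X : Type*} [TopologicalSpace X] [CompactSpace X] (φ : ι → X) (f : C(X, ℂ)) :
    EllTwo ι →L[ℂ] EllTwo ι :=
  LinearMap.mkContinuous
    { toFun := fun ξ => ⟨fun i => f (φ i) * ξ i, memℓp_two_iff.2 <|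
        Summable.of_nonneg_of_le (fun _ => by positivity) (fun i => by
          rw [norm_mul, mul_pow]
          exact mul_le_mul_of_nonneg_right
            (pow_le_pow_left₀ (norm_nonneg _) (f.norm_coe_le_norm _) 2) (by positivity))
          ((EllTwo.summable_norm_sq ξ).mul_left (‖f‖ ^ 2))⟩
      map_add' := fun ξ η => by ext i; exact mul_add _ _ _
      map_smul' := fun c ξ => by ext i; exact mul_left_comm _ _ _ }
    ‖f‖ fun ξ => by
      refine le_of_sq_le_sq ?_ (by positivity)
      rw [mul_pow, EllTwo.norm_sq_eq, EllTwo.norm_sq_eq, ← tsum_mul_left]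
      have h : ∀ i, ‖f (φ i) * ξ i‖ ^ 2 ≤ ‖f‖ ^ 2 * ‖ξ i‖ ^ 2 := fun i => by
        rw [norm_mul, mul_pow]
        exact mul_le_mul_of_nonneg_right
          (pow_le_pow_left₀ (norm_nonneg _) (f.norm_coe_le_norm _) 2) (by positivity)
      exact Summable.tsum_le_tsum h
        (Summable.of_nonneg_of_le (fun _ => by positivity) h
          ((EllTwo.summable_norm_sq ξ).mul_left (‖f‖ ^ 2)))
        ((EllTwo.summable_norm_sq ξ).mul_left (‖f‖ ^ 2))

lemma pullbackOp_apply {ι X : Type*} [TopologicalSpace X] [CompactSpace X] (φ : ι → X)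
    (f : C(X, ℂ)) (ξ : EllTwo ι) (i : ι) : pullbackOp φ f ξ i = f (φ i) * ξ i := rfl

/-- Multiplication operators form a representation of `C(X)` on `ℓ²(ι)`. -/
def pullbackRep {ι X : Type*} [TopologicalSpace X] [CompactSpace X] (φ : ι → X) :
    C(X, ℂ) →⋆ₐ[ℂ] (EllTwo ι →L[ℂ] EllTwo ι) where
  toFun := pullbackOp φ
  map_one' := by ext ξ i; simp [pullbackOp_apply]
  map_mul' f g := by ext ξ i; simp [pullbackOp_apply, mul_assoc]
  map_zero' := by ext ξ i; simp [pullbackOp_apply]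
  map_add' f g := by ext ξ i; simp [pullbackOp_apply, add_mul]
  commutes' c := by
    ext ξ i
    simp [pullbackOp_apply, Algebra.algebraMap_eq_smul_one]
  map_star' f := by
    rw [ContinuousLinearMap.star_eq_adjoint, ContinuousLinearMap.eq_adjoint_iff]
    intro ξ η
    rw [lp.inner_eq_tsum, lp.inner_eq_tsum]
    refine tsum_congr fun i => ?_
    simp [pullbackOp_apply]
    ring

lemma pullbackRep_apply {ι X : Type*} [TopologicalSpace X] [CompactSpace X] (φ : ι → X)
    (f : C(X, ℂ)) (ξ : EllTwo ι) (i : ι) : pullbackRep φ f ξ i = f (φ i) * ξ i := rfl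

/-- The operator on `ℓ²(ι)` induced by a permutation of `ι`. -/
def permOp {ι : Type*} (σ : Equiv.Perm ι) : EllTwo ι →L[ℂ] EllTwo ι :=
  LinearMap.mkContinuous
    { toFun := fun ξ => ⟨fun i => ξ (σ.symm i), memℓp_two_iff.2 <|
        (Equiv.summable_iff σ.symm).2 (EllTwo.summable_norm_sq ξ)⟩
      map_add' := fun ξ η => by ext i; rfl
      map_smul' := fun c ξ => by ext i; rfl }
    1 fun ξ => by
      refine le_of_sq_le_sq ?_ (by positivity)
      rw [one_mul, EllTwo.norm_sq_eq, EllTwo.norm_sq_eq]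
      exact (Equiv.tsum_eq σ.symm fun i => ‖ξ i‖ ^ 2).le

lemma permOp_apply {ι : Type*} (σ : Equiv.Perm ι) (ξ : EllTwo ι) (i : ι) :
    permOp σ ξ i = ξ (σ.symm i) := rfl

lemma permOp_mul {ι : Type*} (σ τ : Equiv.Perm ι) : permOp (σ * τ) = permOp σ * permOp τ := rfl

lemma permOp_one {ι : Type*} : permOp (1 : Equiv.Perm ι) = 1 := rfl

lemma star_permOp {ι : Type*} (σ : Equiv.Perm ι) : star (permOp σ) = permOp σ⁻¹ := by
  symm
  rw [ContinuousLinearMap.star_eq_adjoint, ContinuousLinearMap.eq_adjoint_iff]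
  intro ξ η
  rw [lp.inner_eq_tsum, lp.inner_eq_tsum,
    ← Equiv.tsum_eq σ fun i => inner ℂ (ξ i) (permOp σ η i)]
  refine tsum_congr fun i => ?_
  rw [permOp_apply, permOp_apply, Equiv.symm_apply_apply]
  rfl

/-- The permutation representation of `Perm ι` on `ℓ²(ι)`. -/
def permUnitary (ι : Type*) : Equiv.Perm ι →* unitary (EllTwo ι →L[ℂ] EllTwo ι) where
  toFun σ := ⟨permOp σ, Unitary.mem_iff.2 ⟨by
    rw [star_permOp, ← permOp_mul, inv_mul_cancel, permOp_one], by
    rw [star_permOp, ← permOp_mul, mul_inv_cancel, permOp_one]⟩⟩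
  map_one' := rfl
  map_mul' _ _ := rfl

-- Orbit representations and their vector functionals.

universe u v

/-- The basis vector at `g` in `ℓ²(ι)`. -/
def liftedVec {ι : Type u} (g : ι) : EllTwo (ULift.{v} ι) :=
  haveI := Classical.decEq (ULift.{v} ι)
  lp.single 2 ⟨g⟩ 1

lemma norm_liftedVec {ι : Type u} (g : ι) : ‖(liftedVec g : EllTwo (ULift.{v} ι))‖ = 1 := by
  classical
  simp [liftedVec, lp.norm_single]

lemma inner_liftedVec {ι : Type u} (g : ι) (ξ : EllTwo (ULift.{v} ι)) : inner ℂ (liftedVec g) ξ = ξ ⟨g⟩ := by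
  classical
  simp [liftedVec, lp.inner_single_left]

lemma liftedVec_apply {ι : Type u} (g : ι) (h : ULift.{v} ι) [Decidable (h.down = g)] :
    (liftedVec g : EllTwo (ULift.{v} ι)) h = if h.down = g then 1 else 0 := by
  classical
  rcases h with ⟨h⟩
  by_cases hh : h = g
  · subst hh; simp [liftedVec]
  · simp [liftedVec, hh]

variable {G : Type u} {X : Type v} [Group G] [TopologicalSpace X] [CompactSpace X]
  [MulAction G X] [ContinuousConstSMul G X]

/-- Left translation on `ULift G`. -/
def uliftMulLeft : G →* Equiv.Perm (ULift.{v} G) where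
  toFun g := (Equiv.ulift.trans (Equiv.mulLeft g)).trans Equiv.ulift.symm
  map_one' := by ext; simp
  map_mul' _ _ := by ext; simp

/-- The covariant representation on `ℓ²(G)` attached to a point `x`: `G` acts by left translation
and `f` by multiplication with `g ↦ f (g x)`. -/
def orbitRep (x : X) : CovariantRep G X where
  -- The lift places the Hilbert space in the universe `max u v` that `CovariantRep` prescribes.
  H := EllTwo (ULift.{v} G)
  π := pullbackRep fun g => g.down • x
  U := (permUnitary _).comp uliftMulLeft
  covariant g f := by
    change permOp _ * _ * star (permOp _) = _
    rw [star_permOp]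
    ext ξ i
    have h : uliftMulLeft g ((uliftMulLeft g).symm i) = i := Equiv.apply_symm_apply _ _
    change f (((uliftMulLeft g).symm i).down • x) * ξ (uliftMulLeft g ((uliftMulLeft g).symm i)) = _
    rw [h]
    simp [pullbackRep_apply, translateFun, uliftMulLeft, mul_smul]

/-- The projection of `C(X) ⋊ G` to the summand of a covariant representation. -/
def repOp (ρ : CovariantRep G X) : CrossedProduct G X →L[ℂ] (ρ.H →L[ℂ] ρ.H) :=
  (lp.evalCLM ℂ (fun ρ : CovariantRep G X => ρ.H →L[ℂ] ρ.H) ∞ ρ).comp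
    (crossedProduct G X).toSubmodule.subtypeL

lemma repOp_mul (ρ : CovariantRep G X) (a b : CrossedProduct G X) :
    repOp ρ (a * b) = repOp ρ a * repOp ρ b := rfl

lemma repOp_star (ρ : CovariantRep G X) (a : CrossedProduct G X) :
    repOp ρ (star a) = star (repOp ρ a) := rfl

lemma norm_repOp_le (ρ : CovariantRep G X) (a : CrossedProduct G X) : ‖repOp ρ a‖ ≤ ‖a‖ :=
  lp.norm_apply_le_norm ENNReal.top_ne_zero (a : CovariantProd G X) ρ

/-- The functional `a ↦ ⟨ξ, ρ(a) ξ⟩` on `C(X) ⋊ G`. -/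
def vectorFunctional (ρ : CovariantRep G X) (ξ : ρ.H) : CrossedProduct G X →L[ℂ] ℂ :=
  (innerSL ℂ ξ).comp ((ContinuousLinearMap.apply ℂ ρ.H ξ).comp (repOp ρ))

lemma vectorFunctional_apply (ρ : CovariantRep G X) (ξ : ρ.H) (a : CrossedProduct G X) :
    vectorFunctional ρ ξ a = inner ℂ ξ (repOp ρ a ξ) := rfl

lemma vectorFunctional_star_mul_self (ρ : CovariantRep G X) (ξ : ρ.H) (a : CrossedProduct G X) :
    0 ≤ vectorFunctional ρ ξ (star a * a) := by
  rw [vectorFunctional_apply, repOp_mul, repOp_star, mul_apply_eq_comp,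
    ContinuousLinearMap.star_eq_adjoint, ContinuousLinearMap.adjoint_inner_right]
  rw [inner_self_eq_norm_sq_to_K]
  rw [← RCLike.ofReal_pow]
  exact RCLike.ofReal_nonneg.2 (sq_nonneg _)

end RegularRepresentation

/-! ### Covariant pairs -/

section CovariantPair

set_option linter.unusedSectionVars false

variable {G X : Type*} [Group G] [TopologicalSpace X] [CompactSpace X]
  [MulAction G X] [ContinuousConstSMul G X]

variable (G X) in
/-- A covariant pair in a C*-algebra: a nondegenerate homomorphism of `C(X)` together with
unitaries implementing the action of `G`. -/
structure CovariantPair (A : Type*) [NonUnitalCStarAlgebra A] where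
  /-- the homomorphism of `C(X)` -/
  fn : C(X, ℂ) →⋆ₙₐ[ℂ] A
  /-- the unitaries -/
  u : G → A
  -- `A` is treated as a non-unital algebra throughout; `fn 1` plays the role of its unit.
  one_mul : ∀ a, fn 1 * a = a
  mul_one : ∀ a, a * fn 1 = a
  u_one : u 1 = fn 1
  u_mul : ∀ g h, u (g * h) = u g * u h
  star_u : ∀ g, star (u g) = u g⁻¹
  u_mul_fn : ∀ g f, u g * fn f = fn (translateFun g f) * u g

namespace CovariantPair

variable {A : Type*} [NonUnitalCStarAlgebra A] (P : CovariantPair G X A)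

lemma star_u_mul (g : G) : star (P.u g) * P.u g = P.fn 1 := by
  rw [P.star_u, ← P.u_mul, inv_mul_cancel, P.u_one]

lemma u_mul_star (g : G) : P.u g * star (P.u g) = P.fn 1 := by
  rw [P.star_u, ← P.u_mul, mul_inv_cancel, P.u_one]

lemma norm_fn_le (f : C(X, ℂ)) : ‖P.fn f‖ ≤ ‖f‖ := NonUnitalStarAlgHom.norm_apply_le P.fn f

lemma norm_u_le (g : G) : ‖P.u g‖ ≤ 1 := by
  have h1 : ‖P.u g‖ * ‖P.u g‖ ≤ 1 := by
    rw [← CStarRing.norm_star_mul_self, P.star_u_mul]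
    refine (P.norm_fn_le _).trans ?_
    exact (ContinuousMap.norm_le _ zero_le_one).2 fun x => by simp
  nlinarith [norm_nonneg (P.u g)]

/-- The generators `f u_g` of a covariant pair. -/
def gen (p : C(X, ℂ) × G) : A :=
  P.fn p.1 * P.u p.2

lemma gen_mul (p q : C(X, ℂ) × G) :
    P.gen p * P.gen q =
      P.gen (p.1 * translateFun p.2 q.1, p.2 * q.2) := by
  simp only [gen, map_mul, P.u_mul]
  rw [mul_assoc, ← mul_assoc (P.u p.2), P.u_mul_fn]
  simp only [mul_assoc]

lemma star_gen (p : C(X, ℂ) × G) :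
    star (P.gen p) =
      P.gen (translateFun p.2⁻¹ (star p.1), p.2⁻¹) := by
  simp only [gen]
  rw [star_mul, P.star_u, ← map_star, P.u_mul_fn]

/-- By covariance the span of the elements `f u_g` is already closed under products and adjoints. -/
lemma adjoin_subset_span {a : A}
    (ha : a ∈ NonUnitalStarAlgebra.adjoin ℂ (Set.range P.fn ∪ Set.range P.u)) :
    a ∈ Submodule.span ℂ (Set.range P.gen) := by
  set V := Submodule.span ℂ (Set.range P.gen) with hV
  have hmul : ∀ a ∈ V, ∀ b ∈ V, a * b ∈ V := by
    intro a ha b hb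
    induction ha, hb using Submodule.span_induction₂ with
    | mem_mem a b ha hb =>
      obtain ⟨p, rfl⟩ := ha
      obtain ⟨q, rfl⟩ := hb
      rw [P.gen_mul]
      exact Submodule.subset_span ⟨_, rfl⟩
    | zero_left b hb => simp
    | zero_right a ha => simp
    | add_left a b c _ _ _ h1 h2 => rw [add_mul]; exact add_mem h1 h2
    | add_right a b c _ _ _ h1 h2 => rw [mul_add]; exact add_mem h1 h2
    | smul_left r a b _ _ h => rw [smul_mul_assoc]; exact V.smul_mem _ h
    | smul_right r a b _ _ h => rw [mul_smul_comm]; exact V.smul_mem _ h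
  have hstar : ∀ a ∈ V, star a ∈ V := by
    intro a ha
    induction ha using Submodule.span_induction with
    | mem a ha =>
      obtain ⟨p, rfl⟩ := ha
      rw [P.star_gen]
      exact Submodule.subset_span ⟨_, rfl⟩
    | zero => simp
    | add a b _ _ h1 h2 => rw [star_add]; exact add_mem h1 h2
    | smul r a _ h => rw [star_smul]; exact V.smul_mem _ h
  induction ha using NonUnitalStarAlgebra.adjoin_induction with
  | mem a ha =>
    rcases ha with ⟨f, rfl⟩ | ⟨g, rfl⟩
    · refine Submodule.subset_span ⟨(f, 1), ?_⟩
      rw [gen, P.u_one, P.mul_one]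
    · refine Submodule.subset_span ⟨(1, g), ?_⟩
      rw [gen, P.one_mul]
  | add a b ha hb h1 h2 => exact add_mem h1 h2
  | zero => exact zero_mem V
  | mul a b ha hb h1 h2 => exact hmul _ h1 _ h2
  | smul r a ha h => exact V.smul_mem r h
  | star a ha h => exact hstar _ h

lemma dense_span_subtype {S : NonUnitalStarSubalgebra ℂ A}
    (hS : S = (NonUnitalStarAlgebra.adjoin ℂ (Set.range P.fn ∪ Set.range P.u)).topologicalClosure)
    {γ : C(X, ℂ) × G → S} (hγ : ∀ p, (γ p : A) = P.gen p) :
    Dense (Submodule.span ℂ (Set.range γ) : Set S) := by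
  intro a
  rw [Topology.IsInducing.subtypeVal.closure_eq_preimage_closure_image, Set.mem_preimage]
  refine closure_mono ?_ (hS.le a.2)
  have h1 : Subtype.val '' (Submodule.span ℂ (Set.range γ) : Set S) =
      (Submodule.span ℂ (Set.range P.gen) : Set A) := by
    have h2 := Submodule.map_span S.toSubmodule.subtype (Set.range γ)
    have h3 := congrArg (fun V : Submodule ℂ A => (V : Set A)) h2
    simp only [Submodule.map_coe, ← Set.range_comp] at h3
    refine h3.trans ?_
    congr 3
    funext p
    exact hγ p
  intro b hb
  exact h1.ge (P.adjoin_subset_span hb)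

end CovariantPair

variable (G X) in
/-- A covariant pair generating the C*-algebra `A`, together with the functionals
`f u_k ↦ δ_{k,1} f(g x)`. -/
structure RegularPair (A : Type*) [NonUnitalCStarAlgebra A] extends CovariantPair G X A where
  dense_span : Dense (Submodule.span ℂ (Set.range toCovariantPair.gen) : Set A)
  /-- the vector functionals of the regular representations -/
  orbit : X → G → A →L[ℂ] ℂ
  orbit_nonneg : ∀ x g a, 0 ≤ orbit x g (star a * a)
  norm_orbit_le : ∀ x g a, ‖orbit x g a‖ ≤ ‖a‖
  orbit_fn : ∀ x g f, orbit x g (fn f) = f (g • x)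
  orbit_gen_of_ne : ∀ x g f k, k ≠ 1 → orbit x g (fn f * u k) = 0

namespace RegularPair

variable {A : Type*} [NonUnitalCStarAlgebra A] (P : RegularPair G X A)

/-- The contractive functionals `P.orbit x 1` recover every point evaluation. -/
lemma norm_fn (f : C(X, ℂ)) : ‖P.fn f‖ = ‖f‖ := by
  refine le_antisymm (P.norm_fn_le f) ((ContinuousMap.norm_le _ (norm_nonneg _)).2
    fun x => ?_)
  have h := P.norm_orbit_le x 1 (P.fn f)
  rwa [P.orbit_fn, one_smul] at h

lemma isometry_fn : Isometry P.fn := AddMonoidHomClass.isometry_of_norm _ P.norm_fn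

lemma isClosed_range : IsClosed (NonUnitalStarAlgHom.range P.fn : Set A) := by
  have h := P.isometry_fn.isClosedEmbedding.isClosed_range
  rwa [← NonUnitalStarAlgHom.coe_range] at h

lemma range_ne_bot [Nonempty X] : NonUnitalStarAlgHom.range P.fn ≠ ⊥ := by
  intro h
  have h1 : P.fn 1 ∈ NonUnitalStarAlgHom.range P.fn := ⟨1, rfl⟩
  rw [h, NonUnitalStarAlgebra.mem_bot] at h1
  have h2 := P.norm_fn 1
  rw [h1, norm_zero, norm_one] at h2
  exact zero_ne_one h2

lemma separableSpace [Countable G] [TopologicalSpace.SeparableSpace C(X, ℂ)]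
    (P : RegularPair G X A) :
    TopologicalSpace.SeparableSpace (A) := by
  have h1 : TopologicalSpace.IsSeparable (Set.range (P.gen)) := by
    have h2 : Set.range (P.gen) =
        ⋃ g : G, Set.range fun f => P.gen (f, g) := by
      ext a
      simp [Prod.exists, exists_comm (α := G)]
    rw [h2]
    refine TopologicalSpace.IsSeparable.iUnion fun g => TopologicalSpace.isSeparable_range ?_
    exact P.isometry_fn.continuous.mul_const (P.u g)
  have h3 := (h1.span (R := ℂ)).closure
  rw [P.dense_span.closure_eq] at h3
  exact TopologicalSpace.isSeparable_univ_iff.1 h3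

/-- Every functional that is tracial on the generators `f u_g` is tracial. -/
lemma tracial_of_gen (τ : A →L[ℂ] ℂ)
    (h : ∀ p q, τ (P.gen p * P.gen q) =
      τ (P.gen q * P.gen p)) (a b : A) :
    τ (a * b) = τ (b * a) := by
  have hd := P.dense_span
  have h1 : ∀ p b, τ (P.gen p * b) = τ (b * P.gen p) := by
    intro p b
    have h2 : τ.comp (ContinuousLinearMap.mul ℂ _ (P.gen p)) =
        τ.comp ((ContinuousLinearMap.mul ℂ _).flip (P.gen p)) :=
      ContinuousLinearMap.ext_on hd (by rintro _ ⟨q, rfl⟩; exact h p q)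
    exact congrArg (fun φ : A →L[ℂ] ℂ => φ b) h2
  have h2 : τ.comp ((ContinuousLinearMap.mul ℂ _).flip b) =
      τ.comp (ContinuousLinearMap.mul ℂ _ b) :=
    ContinuousLinearMap.ext_on hd (by rintro _ ⟨q, rfl⟩; exact h1 q b)
  exact congrArg (fun φ : A →L[ℂ] ℂ => φ a) h2

/-- Almost invariant functions almost commute with a given element of `A`. -/
lemma exists_norm_commutator_le (b : A) {η : ℝ} (hη : 0 < η) :
    ∃ (K : Finset G) (ε : ℝ), 0 < ε ∧ ∀ h : C(X, ℂ), ‖h‖ ≤ 1 →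
      (∀ g ∈ K, ‖translateFun g h - h‖ ≤ ε) →
      ‖P.fn h * b - b * P.fn h‖ ≤ η := by
  classical
  have key : ∀ c ∈ Submodule.span ℂ (Set.range (P.gen)), ∀ η : ℝ, 0 < η →
      ∃ (K : Finset G) (ε : ℝ), 0 < ε ∧ ∀ h : C(X, ℂ), (∀ g ∈ K, ‖translateFun g h - h‖ ≤ ε) →
      ‖P.fn h * c - c * P.fn h‖ ≤ η := by
    intro c hc
    induction hc using Submodule.span_induction with
    | mem c hc =>
      obtain ⟨⟨f, g⟩, rfl⟩ := hc
      intro η hη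
      -- The `+ 1` only avoids division by zero when `f = 0`.
      refine ⟨{g}, η / (‖f‖ + 1), by positivity, fun h hh => ?_⟩
      have hh := hh g (Finset.mem_singleton_self g)
      have h1 : P.fn h * P.gen (f, g) -
          P.gen (f, g) * P.fn h =
          P.fn (f * (h - translateFun g h)) * P.u g := by
        simp only [CovariantPair.gen]
        rw [mul_assoc (P.fn f), P.u_mul_fn, ← mul_assoc,
          ← mul_assoc, ← map_mul, ← map_mul, ← sub_mul, ← map_sub, mul_comm h f, mul_sub]
      rw [h1]
      calc _ ≤ ‖f * (h - translateFun g h)‖ * 1 :=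
            (norm_mul_le _ _).trans (mul_le_mul (P.norm_fn_le _)
              (P.norm_u_le g) (norm_nonneg _) (norm_nonneg _))
        _ ≤ ‖f‖ * (η / (‖f‖ + 1)) := by
            rw [mul_one]
            refine (norm_mul_le _ _).trans (mul_le_mul_of_nonneg_left ?_ (norm_nonneg _))
            rwa [norm_sub_rev]
        _ ≤ η := by
            rw [mul_div_assoc', div_le_iff₀ (by positivity)]
            nlinarith [norm_nonneg f]
    | zero => intro η hη; exact ⟨∅, 1, one_pos, fun h _ => by simpa using hη.le⟩
    | add c d _ _ hc hd =>
      intro η hη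
      obtain ⟨K, ε, hε, h1⟩ := hc (η / 2) (half_pos hη)
      obtain ⟨L, ε', hε', h2⟩ := hd (η / 2) (half_pos hη)
      refine ⟨K ∪ L, min ε ε', lt_min hε hε', fun h hh => ?_⟩
      have h3 := h1 h fun g hg => (hh g (Finset.mem_union_left _ hg)).trans (min_le_left _ _)
      have h4 := h2 h fun g hg => (hh g (Finset.mem_union_right _ hg)).trans (min_le_right _ _)
      have h5 : P.fn h * (c + d) - (c + d) * P.fn h =
          (P.fn h * c - c * P.fn h) +
          (P.fn h * d - d * P.fn h) := by noncomm_ring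
      rw [h5]
      linarith [norm_add_le (P.fn h * c - c * P.fn h)
        (P.fn h * d - d * P.fn h)]
    | smul r c _ hc =>
      intro η hη
      obtain ⟨K, ε, hε, h1⟩ := hc (η / (‖r‖ + 1)) (by positivity)
      refine ⟨K, ε, hε, fun h hh => ?_⟩
      rw [mul_smul_comm, smul_mul_assoc, ← smul_sub, norm_smul]
      calc _ ≤ ‖r‖ * (η / (‖r‖ + 1)) := mul_le_mul_of_nonneg_left (h1 h hh) (norm_nonneg _)
        _ ≤ η := by
            rw [mul_div_assoc', div_le_iff₀ (by positivity)]
            nlinarith [norm_nonneg r]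
  -- Replacing `b` by `c` costs `η / 4` on each side of the commutator, and `c` itself contributes
  -- `η / 2`. The bound `‖h‖ ≤ 1` is needed only for this replacement.
  obtain ⟨c, hc, hbc⟩ := Metric.dense_iff.1 P.dense_span b (η / 4)
    (by positivity)
  obtain ⟨K, ε, hε, h1⟩ := key c hbc (η / 2) (half_pos hη)
  refine ⟨K, ε, hε, fun h hh hK => ?_⟩
  have h2 := h1 h hK
  have h3 : ‖b - c‖ ≤ η / 4 := by
    rw [← dist_eq_norm, dist_comm]; exact (Metric.mem_ball.1 hc).le
  have h4 : P.fn h * b - b * P.fn h =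
      (P.fn h * c - c * P.fn h) +
      P.fn h * (b - c) - (b - c) * P.fn h := by noncomm_ring
  have h5 : ‖P.fn h‖ ≤ 1 := (P.norm_fn_le h).trans hh
  have h6 : ‖P.fn h * (b - c)‖ ≤ 1 * (η / 4) :=
    (norm_mul_le _ _).trans (mul_le_mul h5 h3 (norm_nonneg _) zero_le_one)
  have h7 : ‖(b - c) * P.fn h‖ ≤ η / 4 * 1 :=
    (norm_mul_le _ _).trans (mul_le_mul h3 h5 (norm_nonneg _) (by positivity))
  rw [h4]
  refine (norm_sub_le _ _).trans ?_
  have h8 := norm_add_le (P.fn h * c - c * P.fn h)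
    (P.fn h * (b - c))
  linarith

end RegularPair

end CovariantPair

/-! ### The generators of the crossed product -/

section Generators

universe u v

variable {G : Type u} {X : Type v} [Group G] [TopologicalSpace X] [CompactSpace X]
  [MulAction G X] [ContinuousConstSMul G X]

variable (G X) in
/-- The universal covariant pair. -/
def univPair : CovariantPair G X (CovariantProd G X) where
  fn := univFun G X
  u := univUnitary G X
  one_mul a := lp.ext <| funext fun ρ =>
    show ρ.π 1 * a ρ = a ρ by rw [map_one, one_mul]
  mul_one a := lp.ext <| funext fun ρ =>
    show a ρ * ρ.π 1 = a ρ by rw [map_one, mul_one]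
  u_one := lp.ext <| funext fun ρ =>
    show (ρ.U 1 : ρ.H →L[ℂ] ρ.H) = ρ.π 1 by rw [map_one, map_one]; rfl
  u_mul g h := lp.ext <| funext fun ρ =>
    show (ρ.U (g * h) : ρ.H →L[ℂ] ρ.H) = ρ.U g * ρ.U h by rw [map_mul]; rfl
  star_u g := lp.ext <| funext fun ρ =>
    show star (ρ.U g : ρ.H →L[ℂ] ρ.H) = ρ.U g⁻¹ by rw [map_inv]; rfl
  u_mul_fn g f := lp.ext <| funext fun ρ =>
    show (ρ.U g : ρ.H →L[ℂ] ρ.H) * ρ.π f = ρ.π (translateFun g f) * ρ.U g by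
      rw [← ρ.covariant, mul_assoc, Unitary.coe_star_mul_self, mul_one]

variable (X) in
/-- The canonical unitaries of `C(X) ⋊ G`. -/
def crossedProductUnitary (g : G) : CrossedProduct G X :=
  ⟨univUnitary G X g, NonUnitalStarSubalgebra.le_topologicalClosure _
    (NonUnitalStarAlgebra.subset_adjoin ℂ _ (Or.inr ⟨g, rfl⟩))⟩

variable (G X) in
/-- The canonical covariant pair in `C(X) ⋊ G`. -/
def crossedProductPair : CovariantPair G X (CrossedProduct G X) where
  fn := crossedProductFun G X
  u := crossedProductUnitary X
  one_mul a := Subtype.ext ((univPair G X).one_mul a)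
  mul_one a := Subtype.ext ((univPair G X).mul_one a)
  u_one := Subtype.ext (univPair G X).u_one
  u_mul g h := Subtype.ext ((univPair G X).u_mul g h)
  star_u g := Subtype.ext ((univPair G X).star_u g)
  u_mul_fn g f := Subtype.ext ((univPair G X).u_mul_fn g f)

lemma norm_vectorFunctional_orbitRep_le (x : X) (g : G) (a : CrossedProduct G X) :
    ‖vectorFunctional (orbitRep x) (liftedVec g : EllTwo (ULift.{v} G)) a‖ ≤ ‖a‖ := by
  have h1 : ‖(liftedVec g : EllTwo (ULift.{v} G))‖ = 1 := norm_liftedVec g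
  refine (norm_inner_le_norm (𝕜 := ℂ) (liftedVec g : EllTwo (ULift.{v} G)) _).trans ?_
  rw [h1, one_mul]
  refine (ContinuousLinearMap.le_opNorm (repOp (orbitRep x) a) _).trans ?_
  refine (mul_le_mul_of_nonneg_left h1.le (norm_nonneg _)).trans ?_
  rw [mul_one]
  exact norm_repOp_le _ _

variable (G X) in
/-- `C(X) ⋊ G` with its canonical covariant pair and regular representations. -/
def crossedProductRegularPair : RegularPair G X (CrossedProduct G X) where
  toCovariantPair := crossedProductPair G X
  dense_span := (univPair G X).dense_span_subtype rfl fun _ => rfl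
  orbit x g := vectorFunctional (orbitRep x) (liftedVec g : EllTwo (ULift.{v} G))
  orbit_nonneg x g a := vectorFunctional_star_mul_self _ _ a
  norm_orbit_le x g a := norm_vectorFunctional_orbitRep_le x g a
  orbit_fn x g f := (inner_liftedVec g _).trans <| by
    classical
    change f (g • x) * (liftedVec g : EllTwo (ULift.{v} G)) ⟨g⟩ = _
    rw [liftedVec_apply, if_pos rfl, mul_one]
  orbit_gen_of_ne x g f k hk := (inner_liftedVec g _).trans <| by
    classical
    -- The unitary of `k` moves the basis vector at `g` to the one at `k g`, which is orthogonal to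
    -- it unless `k = 1`.
    change f (g • x) * (liftedVec g : EllTwo (ULift.{v} G)) ⟨k⁻¹ * g⟩ = _
    rw [liftedVec_apply, if_neg (by simpa using hk), mul_zero]

end Generators

/-! ### Positive functionals, the trace space and limit traces -/

section Traces

/-! ### Hermitian symmetry and Cauchy–Schwarz for positive functionals. -/

section PositiveFunctional

variable {A F : Type*} [NonUnitalCStarAlgebra A] [FunLike F A ℂ] [LinearMapClass F ℂ A ℂ]

lemma star_eq_self_of_isUnit {e : A} (he : ∀ a, e * a = a ∧ a * e = a) : star e = e := by
  have h1 : star e * e = star e := (he _).2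
  have h2 := congrArg star h1
  rw [star_mul, star_star] at h2
  exact h1.symm.trans h2

lemma norm_unit_le_one {e : A} (he : ∀ a, e * a = a ∧ a * e = a) : ‖e‖ ≤ 1 := by
  have h := CStarRing.norm_star_mul_self (x := e)
  rw [(he _).2, norm_star] at h
  by_contra hc
  nlinarith [norm_nonneg e]

/-- Polarization against the unit: the value at `(c a + e)^* (c a + e)` is real, hence so is the
cross term; the choices `c = 1` and `c = i` give the two components. -/
lemma map_star_of_nonneg {e : A} (he : ∀ a, e * a = a ∧ a * e = a) {τ : F}
    (hτ : ∀ a, 0 ≤ τ (star a * a)) (a : A) : τ (star a) = star (τ a) := by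
  have hs := star_eq_self_of_isUnit he
  have key : ∀ c : ℂ, (star c * τ (star a) + c * τ a).im = 0 := by
    intro c
    have h1 : star (c • a + e) * (c • a + e) =
        star (c • a) * (c • a) + (star c • star a + c • a) + star e * e := by
      simp only [star_add, hs, mul_add, add_mul, (he _).1, (he _).2, star_smul]
      abel
    have h2 := (Complex.le_def.1 (hτ (c • a + e))).2
    have h3 := (Complex.le_def.1 (hτ (c • a))).2
    have h4 := (Complex.le_def.1 (hτ e)).2
    rw [h1, map_add, map_add, map_add, map_smul, map_smul] at h2
    simp only [Complex.add_im, Complex.zero_im, smul_eq_mul] at h2 h3 h4 ⊢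
    linarith
  have h1 := key 1
  have h2 := key Complex.I
  simp at h1 h2
  apply Complex.ext
  · simp; linarith
  · simp; linarith

lemma norm_sq_le_of_nonneg {e : A} (he : ∀ a, e * a = a ∧ a * e = a) {τ : F}
    (hτ : ∀ a, 0 ≤ τ (star a * a)) (a : A) :
    ‖τ a‖ ^ 2 ≤ (τ e).re * (τ (star a * a)).re := by
  have hs := star_eq_self_of_isUnit he
  have he0 : 0 ≤ (τ e).re := by
    have h := (Complex.le_def.1 (hτ e)).1
    rwa [(he _).2, hs] at h
  have hei : (τ e).im = 0 := by
    have h := (Complex.le_def.1 (hτ e)).2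
    rw [(he _).2, hs] at h
    exact h.symm
  have key : ∀ t : ℝ, 0 ≤ (τ (star a * a)).re - 2 * t * ‖τ a‖ ^ 2 + t ^ 2 * ‖τ a‖ ^ 2 * (τ e).re := by
    intro t
    -- Positivity at `a - t τ(a) e` gives the quadratic in `t` behind Cauchy–Schwarz.
    set c : ℂ := t * τ a with hc
    have h1 : star (a - c • e) * (a - c • e) =
        star a * a - c • star a - star c • a + (star c * c) • e := by
      simp only [star_sub, hs, mul_sub, sub_mul, star_smul, smul_mul_assoc, mul_smul_comm,
        (he _).1, (he _).2, smul_sub, smul_smul]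
      rw [mul_comm (star c) c]
      abel
    have h2 := (Complex.le_def.1 (hτ (a - c • e))).1
    rw [h1, map_add, map_sub, map_sub, map_smul, map_smul, map_smul,
      map_star_of_nonneg he hτ] at h2
    have h3 : ‖τ a‖ ^ 2 = (τ a).re ^ 2 + (τ a).im ^ 2 := by
      rw [← Complex.normSq_eq_norm_sq, Complex.normSq_apply]; ring
    rw [h3]
    simp [hc, hei] at h2
    nlinarith [h2]
  rcases eq_or_lt_of_le he0 with h0 | h0
  -- If `τ(e) = 0` the quadratic is linear in `t`, and a large `t` makes it negative unless `τ(a) =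
  -- 0`.
  · rw [← h0] at key ⊢
    have h1 := key (((τ (star a * a)).re + 1) / ‖τ a‖ ^ 2)
    by_contra hc
    have h2 : 0 < ‖τ a‖ ^ 2 := by linarith
    have h3 : (τ (star a * a)).re + 1 = ((τ (star a * a)).re + 1) / ‖τ a‖ ^ 2 * ‖τ a‖ ^ 2 :=
      (div_mul_cancel₀ _ h2.ne').symm
    have h4 := (Complex.le_def.1 (hτ a)).1
    simp only [Complex.zero_re] at h4
    nlinarith
  -- The minimizer of the quadratic.
  · have h1 := key (1 / (τ e).re)
    have h2 : (τ (star a * a)).re - 2 * (1 / (τ e).re) * ‖τ a‖ ^ 2 +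
        (1 / (τ e).re) ^ 2 * ‖τ a‖ ^ 2 * (τ e).re =
        (τ (star a * a)).re - ‖τ a‖ ^ 2 / (τ e).re := by
      field_simp; ring
    rw [h2, sub_nonneg, div_le_iff₀ h0] at h1
    linarith

end PositiveFunctional

/-! ### Weak* compactness of the trace space, and the uniform 2-norm. -/

variable {A : Type*} [NonUnitalCStarAlgebra A]

/-- A positive functional attains its norm at the unit: with `N` the norm, Cauchy–Schwarz gives `N²
≤ τ(e) N`. This is what turns the condition of norm one, which is not visibly weak* closed, into the
closed condition `τ e = 1`. -/
lemma norm_toStrongDual_of_nonneg {e : A} (he : ∀ a, e * a = a ∧ a * e = a) {τ : WeakDual ℂ A}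
    (hτ : ∀ a, 0 ≤ τ (star a * a)) : (‖WeakDual.toStrongDual τ‖ : ℂ) = τ e := by
  have hs := star_eq_self_of_isUnit he
  have h0 := hτ e
  rw [(he _).2, hs] at h0
  have h1 : (τ e) = ((τ e).re : ℂ) := by
    apply Complex.ext
    · simp
    · simpa using (Complex.le_def.1 h0).2.symm
  have h2 : 0 ≤ (τ e).re := (Complex.le_def.1 h0).1
  rw [h1]
  congr 1
  set N := ‖WeakDual.toStrongDual τ‖ with hN
  have hN0 : 0 ≤ N := norm_nonneg _
  apply le_antisymm
  · have h3 : N ≤ Real.sqrt ((τ e).re * N) := by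
      refine ContinuousLinearMap.opNorm_le_bound _ (Real.sqrt_nonneg _) fun a => ?_
      have h4 : ‖τ a‖ ^ 2 ≤ (τ e).re * (N * ‖a‖ ^ 2) := by
        refine (norm_sq_le_of_nonneg he hτ a).trans (mul_le_mul_of_nonneg_left ?_ h2)
        have h5 : ‖τ (star a * a)‖ ≤ N * ‖star a * a‖ :=
          (WeakDual.toStrongDual τ).le_opNorm _
        rw [CStarRing.norm_star_mul_self, ← sq] at h5
        exact (Complex.re_le_norm _).trans h5
      change ‖τ a‖ ≤ _
      refine le_of_sq_le_sq ?_ (by positivity)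
      rw [mul_pow, Real.sq_sqrt (by positivity), mul_assoc]
      exact h4
    have h4 : N ^ 2 ≤ (τ e).re * N := (Real.le_sqrt hN0 (by positivity)).1 h3
    by_contra hc
    push Not at hc
    nlinarith
  · have h3 : ‖τ e‖ ≤ N * ‖e‖ := (WeakDual.toStrongDual τ).le_opNorm _
    have h4 := norm_unit_le_one he
    have h5 := Complex.re_le_norm (τ e)
    nlinarith

lemma mem_traceSpace_iff {e : A} (he : ∀ a, e * a = a ∧ a * e = a) {τ : WeakDual ℂ A} :
    τ ∈ traceSpace A ↔
      (∀ a : A, 0 ≤ τ (star a * a)) ∧ τ e = 1 ∧ ∀ a b : A, τ (a * b) = τ (b * a) := by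
  refine and_congr_right fun h => and_congr_left fun _ => ?_
  rw [← norm_toStrongDual_of_nonneg he h]
  norm_cast

lemma norm_apply_le_of_mem_traceSpace {τ : WeakDual ℂ A} (hτ : τ ∈ traceSpace A) (a : A) :
    ‖τ a‖ ≤ ‖a‖ := by
  have h : ‖τ a‖ ≤ ‖WeakDual.toStrongDual τ‖ * ‖a‖ := (WeakDual.toStrongDual τ).le_opNorm _
  rwa [hτ.2.1, one_mul] at h

lemma isCompact_traceSpace_of_unit {e : A} (he : ∀ a, e * a = a ∧ a * e = a) :
    IsCompact (traceSpace A) := by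
  have hc : ∀ a : A, Continuous fun τ : WeakDual ℂ A => τ a := WeakDual.eval_continuous
  have h1 : traceSpace A = (⋂ a : A, {τ | 0 ≤ τ (star a * a)}) ∩ ({τ | τ e = 1} ∩
      ⋂ a : A, ⋂ b : A, {τ | τ (a * b) = τ (b * a)}) := by
    ext τ
    simp [mem_traceSpace_iff he]
  refine WeakDual.isCompact_of_bounded_of_closed ?_ ?_
  · refine (Metric.isBounded_closedBall (x := (0 : StrongDual ℂ A)) (r := 1)).subset fun τ hτ => ?_
    rw [mem_closedBall_zero_iff]
    exact (show StrongDual.toWeakDual τ ∈ traceSpace A from hτ).2.1.le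
  · rw [h1]
    refine IsClosed.inter (isClosed_iInter fun a => isClosed_le continuous_const (hc _)) <|
      IsClosed.inter (isClosed_eq (hc _) continuous_const) <| isClosed_iInter fun a =>
        isClosed_iInter fun b => isClosed_eq (hc _) (hc _)

/-- Contractive functionals converge pointwise along ultrafilters. -/
lemma exists_tendsto_of_norm_apply_le {ι E : Type*} [NormedAddCommGroup E] [NormedSpace ℂ E]
    (V : Ultrafilter ι) (φ : ι → E →L[ℂ] ℂ) (hφ : ∀ i a, ‖φ i a‖ ≤ ‖a‖) :
    ∃ τ : E →L[ℂ] ℂ, ∀ a, Tendsto (fun i => φ i a) V (𝓝 (τ a)) := by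
  have hc := WeakDual.isCompact_closedBall (𝕜 := ℂ) (E := E) 0 1
  obtain ⟨τ, _, hτ⟩ := hc.ultrafilter_le_nhds' (V.map fun i => StrongDual.toWeakDual (φ i)) <| by
    rw [Ultrafilter.mem_map]
    refine univ_mem' fun i => ?_
    change φ i ∈ Metric.closedBall 0 1
    rw [mem_closedBall_zero_iff]
    exact ContinuousLinearMap.opNorm_le_bound _ zero_le_one fun a => by rw [one_mul]; exact hφ i a
  refine ⟨WeakDual.toStrongDual τ, fun a => ?_⟩
  exact ((WeakDual.eval_continuous a).tendsto τ).comp hτ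

lemma twoNorm_le_norm (a : A) : twoNorm (traceSpace A) a ≤ ‖a‖ :=
  twoNorm_le (norm_nonneg _) fun τ hτ => by
    refine (Complex.re_le_norm _).trans ((norm_apply_le_of_mem_traceSpace hτ _).trans ?_)
    rw [CStarRing.norm_star_mul_self, sq]

lemma twoNorm_sub_le (a b : A) :
    twoNorm (traceSpace A) (a - b) ≤
      2 * (twoNorm (traceSpace A) a + twoNorm (traceSpace A) b) := by
  have h := twoNorm_add_le a (-b)
  have h1 := twoNorm_smul_le (-1) b
  rw [neg_one_smul, norm_neg, norm_one, one_mul] at h1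
  rw [sub_eq_add_neg]
  linarith

lemma norm_le_twoNorm {e : A} (he : ∀ a, e * a = a ∧ a * e = a) {τ : WeakDual ℂ A}
    (hτ : τ ∈ traceSpace A) (a : A) : ‖τ a‖ ≤ twoNorm (traceSpace A) a := by
  refine le_of_sq_le_sq ?_ (twoNorm_nonneg a)
  have h := norm_sq_le_of_nonneg he hτ.1 a
  rw [((mem_traceSpace_iff he).1 hτ).2.1, Complex.one_re, one_mul] at h
  exact h.trans (re_le_twoNorm_sq hτ a)

/-! ### Limit traces. -/

variable {𝓤 : Ultrafilter ℕ}

/-- Every sequence of traces has a limit trace. -/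
lemma exists_limitTrace {e : A} (he : ∀ a, e * a = a ∧ a * e = a) {τ : ℕ → WeakDual ℂ A}
    (hτ : ∀ n, τ n ∈ traceSpace A) : ∃ φ ∈ limitTraces A 𝓤,
      ∀ a : BddSeq A, Tendsto (fun n => τ n (a n)) 𝓤 (𝓝 (φ (toUltrapower 𝓤 a))) := by
  obtain ⟨Φ, hΦ⟩ := exists_tendsto_of_norm_apply_le 𝓤
    (fun n => (WeakDual.toStrongDual (τ n)).comp (lp.evalCLM ℂ (fun _ : ℕ => A) ∞ n))
    fun n a => (norm_apply_le_of_mem_traceSpace (hτ n) (a n)).trans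
      (lp.norm_apply_le_norm ENNReal.top_ne_zero a n)
  -- Traces are dominated by the uniform 2-norm, so the limit functional descends to the quotient.
  have hker : traceKernel A 𝓤 ≤ LinearMap.ker Φ.toLinearMap := fun a ha => by
    have h1 : Tendsto (fun n => τ n (a n)) 𝓤 (𝓝 0) :=
      squeeze_zero_norm (fun n => norm_le_twoNorm he (hτ n) (a n)) ha
    exact tendsto_nhds_unique (hΦ a) h1
  exact ⟨(traceKernel A 𝓤).liftQ Φ.toLinearMap hker, ⟨τ, hτ, hΦ⟩, hΦ⟩

lemma limitTraces_nonneg {φ : TracialUltrapower A 𝓤 →ₗ[ℂ] ℂ} (hφ : φ ∈ limitTraces A 𝓤)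
    (x : TracialUltrapower A 𝓤) : 0 ≤ φ (star x * x) := by
  obtain ⟨τ, hτ, h⟩ := hφ
  obtain ⟨a, rfl⟩ := toUltrapower_surjective 𝓤 x
  exact ge_of_tendsto' (h (star a * a)) fun n => (hτ n).1 (a n)

lemma limitTraces_mul_comm {φ : TracialUltrapower A 𝓤 →ₗ[ℂ] ℂ} (hφ : φ ∈ limitTraces A 𝓤)
    (x y : TracialUltrapower A 𝓤) : φ (x * y) = φ (y * x) := by
  obtain ⟨τ, hτ, h⟩ := hφ
  obtain ⟨a, rfl⟩ := toUltrapower_surjective 𝓤 x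
  obtain ⟨b, rfl⟩ := toUltrapower_surjective 𝓤 y
  exact tendsto_nhds_unique (h (a * b))
    ((h (b * a)).congr fun n => (hτ n).2.2 (b n) (a n))

lemma norm_limitTraces_le {φ : TracialUltrapower A 𝓤 →ₗ[ℂ] ℂ} (hφ : φ ∈ limitTraces A 𝓤)
    (a : BddSeq A) : ‖φ (toUltrapower 𝓤 a)‖ ≤ ‖a‖ := by
  obtain ⟨τ, hτ, h⟩ := hφ
  exact le_of_tendsto' (h a).norm fun n =>
    (norm_apply_le_of_mem_traceSpace (hτ n) (a n)).trans
      (lp.norm_apply_le_norm ENNReal.top_ne_zero a n)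

/-- Otherwise traces nearly attaining the 2-norm of `a n` on a `𝓤`-large set of `n` would have a
limit trace violating the assumed bound. -/
lemma eventually_twoNorm_lt {e : A} (he : ∀ a, e * a = a ∧ a * e = a)
    (hT : (traceSpace A).Nonempty) {a : BddSeq A} {ε : ℝ}
    (ha : twoNorm (limitTraces A 𝓤) (toUltrapower 𝓤 a) < ε) :
    ∀ᶠ n in 𝓤, twoNorm (traceSpace A) (a n) < ε := by
  obtain ⟨τ₀, hτ₀⟩ := hT
  by_contra hc
  rw [← Ultrafilter.eventually_not] at hc
  obtain ⟨η, hη1, hη2⟩ := exists_between ha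
  have h1 : ∀ n, ∃ τ ∈ traceSpace A, ε ≤ twoNorm (traceSpace A) (a n) →
      η < Real.sqrt (τ (star (a n) * a n)).re := by
    intro n
    by_cases hn : ε ≤ twoNorm (traceSpace A) (a n)
    · have : Nonempty (traceSpace A) := ⟨⟨τ₀, hτ₀⟩⟩
      obtain ⟨τ, hτ⟩ := exists_lt_of_lt_ciSup (hη2.trans_le hn)
      exact ⟨τ, τ.2, fun _ => hτ⟩
    · exact ⟨τ₀, hτ₀, fun h => absurd h hn⟩
  choose τ hτ hτ2 using h1
  obtain ⟨φ, hφ, hlim⟩ := exists_limitTrace (𝓤 := 𝓤) he hτ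
  have h2 : η ≤ Real.sqrt (φ (star (toUltrapower 𝓤 a) * toUltrapower 𝓤 a)).re := by
    refine ge_of_tendsto ((Real.continuous_sqrt.tendsto _).comp
      ((Complex.continuous_re.tendsto _).comp (hlim (star a * a)))) ?_
    filter_upwards [hc] with n hn
    exact (hτ2 n (not_lt.1 hn)).le
  -- Boundedness matters: a real supremum over an unbounded family is `0` by convention.
  have hb : BddAbove (Set.range fun φ : limitTraces A 𝓤 =>
      Real.sqrt ((φ : TracialUltrapower A 𝓤 →ₗ[ℂ] ℂ)
        (star (toUltrapower 𝓤 a) * toUltrapower 𝓤 a)).re) := by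
    refine ⟨Real.sqrt ‖star a * a‖, ?_⟩
    rintro _ ⟨⟨ψ, hψ⟩, rfl⟩
    exact Real.sqrt_le_sqrt ((Complex.re_le_norm _).trans (norm_limitTraces_le hψ (star a * a)))
  have h3 : Real.sqrt (φ (star (toUltrapower 𝓤 a) * toUltrapower 𝓤 a)).re ≤
      twoNorm (limitTraces A 𝓤) (toUltrapower 𝓤 a) := le_ciSup hb ⟨φ, hφ⟩
  linarith

/-- A contractive sequence that asymptotically commutes in norm with representatives of a
`‖·‖_2`-dense set commutes with the whole set. -/
lemma commute_of_tendsto_commutator {e : A} (he : ∀ a, e * a = a ∧ a * e = a)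
    (hT : (traceSpace A).Nonempty) {c : BddSeq A} (hc : ‖c‖ ≤ 1) {s : TracialUltrapower A 𝓤}
    (h : ∀ ε > 0, ∃ b : BddSeq A, twoNorm (limitTraces A 𝓤) (s - toUltrapower 𝓤 b) < ε ∧
      Tendsto (fun n => ‖c n * b n - b n * c n‖) 𝓤 (𝓝 0)) :
    Commute (toUltrapower 𝓤 c) s := by
  obtain ⟨s, rfl⟩ := toUltrapower_surjective 𝓤 s
  have key : c * s - s * c ∈ traceKernel A 𝓤 := by
    refine Metric.tendsto_nhds.2 fun ε hε => ?_
    -- The triangle inequality is available with a factor `2`; applied twice to errors `ε / 12` it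
    -- gives `2 (1 + 2 · 2) ε / 12 < ε`.
    obtain ⟨b, hb1, hb2⟩ := h (ε / 12) (by positivity)
    filter_upwards [eventually_twoNorm_lt (a := s - b) he hT hb1,
      (tendsto_order.1 hb2).2 (ε / 12) (by positivity)] with n h1 h2
    rw [Real.dist_eq, sub_zero, abs_of_nonneg (twoNorm_nonneg _)]
    change twoNorm (traceSpace A) (c n * s n - s n * c n) < ε
    change twoNorm (traceSpace A) (s n - b n) < _ at h1
    have h3 : c n * s n - s n * c n =
        (c n * b n - b n * c n) + (c n * (s n - b n) - (s n - b n) * c n) := by noncomm_ring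
    have hcn : ‖c n‖ ≤ 1 := (lp.norm_apply_le_norm ENNReal.top_ne_zero c n).trans hc
    have h4 := twoNorm_mul_le (c n) (s n - b n)
    have h5 := twoNorm_mul_le' (s n - b n) (c n)
    have h6 := twoNorm_sub_le (c n * (s n - b n)) ((s n - b n) * c n)
    have h7 := twoNorm_add_le (c n * b n - b n * c n)
      (c n * (s n - b n) - (s n - b n) * c n)
    have h8 := twoNorm_le_norm (c n * b n - b n * c n)
    have h9 := twoNorm_nonneg (s n - b n)
    rw [h3]
    nlinarith
  exact (Submodule.Quotient.eq (traceKernel A 𝓤)).2 key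

end Traces

/-! ### Følner averages -/

section Folner

set_option linter.unusedSectionVars false

variable {G X : Type*} [Group G] [TopologicalSpace X] [CompactSpace X]
  [MulAction G X] [ContinuousConstSMul G X]

/-- `F` is `(K, ε)`-invariant: `|gF ∆ F| ≤ ε |F|` for all `g ∈ K`. -/
def IsFolner (K : Finset G) (ε : ℝ) (F : Finset G) : Prop :=
  ∀ g ∈ K, (((g • (F : Set G)) ∆ (F : Set G)).ncard : ℝ) ≤ ε * (F.card : ℝ)

/-- The terms over `gF ∩ F` cancel, which leaves a sum over the symmetric difference. -/
lemma norm_sum_translate_sub_le {E : Type*} [SeminormedAddCommGroup E] (F : Finset G) (g : G)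
    (φ : G → E) {M : ℝ} (hφ : ∀ s, ‖φ s‖ ≤ M) :
    ‖∑ s ∈ F, φ (g * s) - ∑ s ∈ F, φ s‖ ≤ (((g • (F : Set G)) ∆ (F : Set G)).ncard : ℝ) * M := by
  classical
  have h1 : ∑ s ∈ F, φ (g * s) = ∑ s ∈ g • F, φ s := by
    rw [Finset.smul_finset_def, Finset.sum_image fun a _ b _ h => smul_left_cancel g h]
    rfl
  have h2 : (g • (F : Set G)) ∆ (F : Set G) = ((g • F) ∆ F : Finset G) := by
    rw [Finset.coe_symmDiff, Finset.coe_smul_finset]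
  have h3 : ∀ S : Finset G, ‖∑ s ∈ S, φ s‖ ≤ S.card * M := fun S => by
    refine (norm_sum_le_of_le S fun s _ => hφ s).trans ?_
    rw [Finset.sum_const, nsmul_eq_mul]
  rw [h1, h2, Set.ncard_coe_finset, ← Finset.sum_sdiff_sub_sum_sdiff]
  refine (norm_sub_le _ _).trans ((add_le_add (h3 _) (h3 _)).trans ?_)
  rw [symmDiff_def, Finset.sup_eq_union, Finset.card_union_of_disjoint disjoint_sdiff_sdiff]
  push_cast
  rw [add_mul]

lemma IsFolner.norm_sum_translate_sub_le {E : Type*} [SeminormedAddCommGroup E] {K F : Finset G}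
    {ε : ℝ} (hF : IsFolner K ε F) {g : G} (hg : g ∈ K) {φ : G → E} {M : ℝ}
    (hφ : ∀ s, ‖φ s‖ ≤ M) :
    ‖∑ s ∈ F, φ (g * s) - ∑ s ∈ F, φ s‖ ≤ ε * F.card * M :=
  (_root_.norm_sum_translate_sub_le F g φ hφ).trans
    (mul_le_mul_of_nonneg_right (hF g hg) ((norm_nonneg _).trans (hφ 1)))

/-- A real-valued function as a complex-valued one. -/
def complexify {X : Type*} [TopologicalSpace X] (f : C(X, ℝ)) : C(X, ℂ) :=
  ⟨fun x => (f x : ℂ), Complex.continuous_ofReal.comp f.continuous⟩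

lemma complexify_apply {X : Type*} [TopologicalSpace X] (f : C(X, ℝ)) (x : X) :
    complexify f x = (f x : ℂ) := rfl

/-- The square root of a nonnegative function. -/
def sqrtFun {X : Type*} [TopologicalSpace X] (f : C(X, ℝ)) : C(X, ℝ) :=
  ⟨fun x => Real.sqrt (f x), Real.continuous_sqrt.comp f.continuous⟩

lemma complexify_eq_star_mul_self {X : Type*} [TopologicalSpace X] {f : C(X, ℝ)} (hf : 0 ≤ f) :
    complexify f = star (complexify (sqrtFun f)) * complexify (sqrtFun f) := by
  ext x
  have h : f x = Real.sqrt (f x) * Real.sqrt (f x) := (Real.mul_self_sqrt (hf x)).symm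
  simp only [complexify_apply, ContinuousMap.mul_apply, ContinuousMap.star_apply, sqrtFun,
    ContinuousMap.coe_mk, Complex.star_def, Complex.conj_ofReal]
  exact_mod_cast h

lemma norm_complexify_le {f : C(X, ℝ)} {M : ℝ} (hM : 0 ≤ M) (hf : ∀ x, |f x| ≤ M) :
    ‖complexify f‖ ≤ M :=
  (ContinuousMap.norm_le _ hM).2 fun x => by
    rw [complexify_apply, Complex.norm_real]; exact hf x

namespace RegularPair

variable {A : Type*} [NonUnitalCStarAlgebra A] (P : RegularPair G X A)

lemma fn_one_isUnit (a : A) : P.fn 1 * a = a ∧ a * P.fn 1 = a := ⟨P.one_mul a, P.mul_one a⟩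

/-- The average of the functionals `P.orbit x g` over `g ∈ F`. -/
def average (x : X) (F : Finset G) : A →L[ℂ] ℂ := (F.card : ℂ)⁻¹ • ∑ g ∈ F, P.orbit x g

lemma average_apply (x : X) (F : Finset G) (a : A) :
    P.average x F a = (F.card : ℂ)⁻¹ * ∑ g ∈ F, P.orbit x g a := by
  simp [average]

lemma norm_average_le (x : X) (F : Finset G) (a : A) : ‖P.average x F a‖ ≤ ‖a‖ := by
  rw [average_apply, norm_mul, norm_inv, Complex.norm_natCast]
  have h : ‖∑ g ∈ F, P.orbit x g a‖ ≤ F.card * ‖a‖ := by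
    refine (norm_sum_le_of_le F fun g _ => P.norm_orbit_le x g a).trans ?_
    rw [Finset.sum_const, nsmul_eq_mul]
  rcases F.eq_empty_or_nonempty with rfl | hF
  · simp
  · have hc : (0 : ℝ) < F.card := by exact_mod_cast hF.card_pos
    rw [inv_mul_le_iff₀ hc]
    exact h

lemma average_nonneg (x : X) (F : Finset G) (a : A) : 0 ≤ P.average x F (star a * a) := by
  rw [average_apply]
  refine mul_nonneg ?_ (Finset.sum_nonneg fun g _ => P.orbit_nonneg x g a)
  rw [← Complex.ofReal_natCast, ← Complex.ofReal_inv]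
  exact Complex.zero_le_real.2 (by positivity)

lemma average_fn (x : X) (F : Finset G) (f : C(X, ℂ)) :
    P.average x F (P.fn f) = (F.card : ℂ)⁻¹ * ∑ g ∈ F, f (g • x) := by
  simp only [average_apply, P.orbit_fn]

lemma average_gen_of_ne (x : X) (F : Finset G) (p : C(X, ℂ) × G) (hp : p.2 ≠ 1) :
    P.average x F (P.gen p) = 0 := by
  have h : ∑ g ∈ F, P.orbit x g (P.gen p) = 0 :=
    Finset.sum_eq_zero fun g _ => P.orbit_gen_of_ne x g p.1 p.2 hp
  rw [average_apply, h, mul_zero]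

/-- Limits of averages over Følner sets are tracial states. -/
lemma exists_tendsto_average {ι : Type*} (V : Ultrafilter ι) {F : ι → Finset G} (x : ι → X)
    (hne : ∀ i, (F i).Nonempty) (hF : ∀ g, ∀ ε : ℝ, 0 < ε → ∀ᶠ i in V, IsFolner {g} ε (F i)) :
    ∃ τ ∈ traceSpace A, ∀ a, Tendsto (fun i => P.average (x i) (F i) a) V (𝓝 (τ a)) := by
  obtain ⟨τ, hτ⟩ := exists_tendsto_of_norm_apply_le V (fun i => P.average (x i) (F i))
    fun i a => P.norm_average_le _ _ a
  have hcard : ∀ i, ((F i).card : ℂ) ≠ 0 := fun i => by exact_mod_cast (hne i).card_pos.ne'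
  -- The Følner condition makes the limit invariant on `C(X)`.
  have hinv : ∀ (g : G) (f : C(X, ℂ)), τ (P.fn (translateFun g⁻¹ f)) = τ (P.fn f) := by
    intro g f
    rw [← sub_eq_zero, ← map_sub, ← map_sub]
    refine tendsto_nhds_unique (hτ _) (Metric.tendsto_nhds.2 fun ε hε => ?_)
    filter_upwards [hF g (ε / (‖f‖ + 1)) (by positivity)] with i hi
    rw [dist_zero_right, P.average_fn, norm_mul, norm_inv, Complex.norm_natCast]
    have h1 := hi.norm_sum_translate_sub_le (Finset.mem_singleton_self g)
      (φ := fun s => f (s • x i)) fun s => f.norm_coe_le_norm _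
    have hc : (0 : ℝ) < (F i).card := by exact_mod_cast (hne i).card_pos
    have h2 : ∑ s ∈ F i, (translateFun g⁻¹ f - f) (s • x i) =
        ∑ s ∈ F i, f ((g * s) • x i) - ∑ s ∈ F i, f (s • x i) := by
      rw [← Finset.sum_sub_distrib]
      refine Finset.sum_congr rfl fun s _ => ?_
      simp [translateFun, mul_smul]
    rw [h2, inv_mul_lt_iff₀ hc]
    refine h1.trans_lt ?_
    rw [mul_right_comm, mul_comm ((F i).card : ℝ)]
    refine mul_lt_mul_of_pos_right ?_ hc
    rw [div_mul_eq_mul_div, div_lt_iff₀ (by positivity)]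
    nlinarith [norm_nonneg f]
  refine ⟨StrongDual.toWeakDual τ, (mem_traceSpace_iff P.fn_one_isUnit).2 ⟨fun a => ?_, ?_, ?_⟩, hτ⟩
  · exact ge_of_tendsto' (hτ _) fun i => P.average_nonneg _ _ a
  · refine tendsto_nhds_unique (hτ _) (tendsto_const_nhds.congr fun i => ?_)
    rw [P.average_fn]
    simp [hcard i]
  -- On products of generators `f u_g` and `h u_k` both sides vanish unless `k = g⁻¹`; there the
  -- trace identity is the invariance `hinv`.
  · refine tracial_of_gen P τ fun p q => ?_
    have h0 : ∀ p : C(X, ℂ) × G, p.2 ≠ 1 → τ (P.gen p) = 0 := fun p hp =>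
      tendsto_nhds_unique (hτ _)
        (tendsto_const_nhds.congr fun i => (P.average_gen_of_ne _ _ p hp).symm)
    have h1 : ∀ f, P.gen (f, 1) = P.fn f := fun f => by
      simp only [CovariantPair.gen, P.u_one, P.mul_one]
    obtain ⟨f, g⟩ := p
    obtain ⟨h, k⟩ := q
    rw [P.gen_mul, P.gen_mul]
    by_cases hgk : g * k = 1
    · obtain rfl : k = g⁻¹ := eq_inv_of_mul_eq_one_right hgk
      simp only [mul_inv_cancel, inv_mul_cancel, h1]
      rw [← hinv g]
      congr 2
      ext y
      simp [translateFun, mul_comm]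
    · rw [h0 _ hgk, h0 _ fun h => hgk (mul_eq_one_comm.1 h)]

/-- If every sufficiently invariant finite set `F` admits a point `x` with `Q F x`, then some trace
is a limit of averages over such pairs. -/
lemma exists_trace_of_folner (hG : IsAmenableGroup G) (K : Finset G) {ε : ℝ} (hε : 0 < ε)
    (Q : Finset G → X → Prop) (hQ : ∀ F : Finset G, F.Nonempty → IsFolner K ε F → ∃ x, Q F x) :
    ∃ τ ∈ traceSpace A, ∃ (V : Ultrafilter (Finset G × ℕ)) (F : Finset G × ℕ → Finset G)
      (x : Finset G × ℕ → X),
      (∀ i, Q (F i) (x i)) ∧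
      ∀ a, Tendsto (fun i => P.average (x i) (F i) a) V (𝓝 (τ a)) := by
  classical
  -- An index `(L, n)` asks for invariance under `L` up to `1 / (n + 1)`, so every `g` and every
  -- tolerance are eventually met. Keeping `K` and `ε` in the demand makes `hQ` applicable at every
  -- index.
  have h1 : ∀ i : Finset G × ℕ, ∃ F : Finset G, F.Nonempty ∧
      IsFolner (i.1 ∪ K) (min (1 / ((i.2 : ℝ) + 1)) ε) F :=
    fun i => hG _ _ (lt_min (by positivity) hε)
  choose F hne hF using h1
  have h2 : ∀ i, ∃ x, Q (F i) x := fun i => hQ _ (hne i) fun g hg =>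
    (hF i g (Finset.mem_union_right _ hg)).trans
      (mul_le_mul_of_nonneg_right (min_le_right _ _) (Nat.cast_nonneg _))
  choose x hx using h2
  obtain ⟨τ, hτ, hlim⟩ := P.exists_tendsto_average (Ultrafilter.of atTop) x hne fun g δ hδ => by
    obtain ⟨N, hN⟩ := exists_nat_one_div_lt hδ
    refine Ultrafilter.of_le atTop ?_
    filter_upwards [eventually_ge_atTop (({g}, N) : Finset G × ℕ)] with i hi s hs
    refine (hF i s (Finset.mem_union_left _ (hi.1 hs))).trans
      (mul_le_mul_of_nonneg_right ((min_le_left _ _).trans ?_) (Nat.cast_nonneg _))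
    refine le_trans ?_ hN.le
    have h3 : (N : ℝ) ≤ i.2 := by exact_mod_cast hi.2
    exact one_div_le_one_div_of_le (by positivity) (by linarith)
  exact ⟨τ, hτ, _, F, x, hx, hlim⟩

lemma traceSpace_nonempty [Nonempty X] (P : RegularPair G X A) (hG : IsAmenableGroup G) :
    (traceSpace A).Nonempty := by
  obtain ⟨τ, hτ, _⟩ := P.exists_trace_of_folner hG ∅ one_pos (fun _ _ => True)
    fun _ _ _ => ⟨Classical.arbitrary X, trivial⟩
  exact ⟨τ, hτ⟩

lemma traceSpace_translateFun {τ : WeakDual ℂ A} (hτ : τ ∈ traceSpace A) (g : G) (f : C(X, ℂ)) :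
    τ (P.fn (translateFun g f)) = τ (P.fn f) := by
  have h1 : P.fn (translateFun g f) = P.u g * P.fn f * star (P.u g) := by
    rw [P.u_mul_fn, mul_assoc, P.u_mul_star, P.mul_one]
  rw [h1, hτ.2.2, ← mul_assoc, P.star_u_mul, P.one_mul]

lemma fn_complexify_nonneg {τ : WeakDual ℂ A} (hτ : τ ∈ traceSpace A) {f : C(X, ℝ)}
    (hf : 0 ≤ f) : 0 ≤ (τ (P.fn (complexify f))).re := by
  rw [complexify_eq_star_mul_self hf, map_mul, map_star]
  exact (Complex.le_def.1 (hτ.1 _)).1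

/-- If every trace is negative on one of the functions `f i`, then so is every orbit average over
some sufficiently invariant set. -/
lemma exists_folner_sum_neg (hG : IsAmenableGroup G) {κ : Type*} {f : κ → C(X, ℝ)}
    (hf : ∀ τ ∈ traceSpace A, ∃ i, (τ (P.fn (complexify (f i)))).re < 0)
    (K : Finset G) {ε : ℝ} (hε : 0 < ε) :
    ∃ F : Finset G, F.Nonempty ∧ IsFolner K ε F ∧ ∀ x, ∃ i, ∑ g ∈ F, f i (g • x) < 0 := by
  by_contra hc
  push Not at hc
  -- If each sufficiently invariant set had a point where all sums are nonnegative, the limit of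
  -- averages at such points would be a trace nonnegative on all `f i`.
  obtain ⟨τ, hτ, V, F, x, hFx, hlim⟩ := P.exists_trace_of_folner hG K hε
    (fun F x => ∀ i, 0 ≤ ∑ g ∈ F, f i (g • x)) hc
  obtain ⟨i, hi⟩ := hf τ hτ
  have h1 : 0 ≤ (τ (P.fn (complexify (f i)))).re := by
    refine ge_of_tendsto' ((Complex.continuous_re.tendsto _).comp (hlim _)) fun j => ?_
    have h2 : P.average (x j) (F j) (P.fn (complexify (f i))) =
        (((F j).card : ℝ)⁻¹ * ∑ g ∈ F j, f i (g • x j) : ℝ) := by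
      rw [P.average_fn]
      simp [complexify_apply]
    simp only [Function.comp, h2, Complex.ofReal_re]
    exact mul_nonneg (by positivity) (hFx j i)
  linarith

/-- An almost invariant partition of unity subordinate to the negativity of the `f i`. -/
lemma exists_partition (hG : IsAmenableGroup G) {κ : Type*} [Fintype κ] {f : κ → C(X, ℝ)}
    (hf : ∀ τ ∈ traceSpace A, ∃ i, (τ (P.fn (complexify (f i)))).re < 0)
    (K : Finset G) {ε : ℝ} (hε : 0 < ε) :
    ∃ e : κ → C(X, ℝ), (∀ i, 0 ≤ e i) ∧ ∑ i, e i = 1 ∧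
      (∀ i, ∀ g ∈ K, ‖translateFun g (complexify (e i)) - complexify (e i)‖ ≤ ε) ∧
      ∀ τ ∈ traceSpace A, ∀ i, (τ (P.fn (complexify (f i * e i)))).re ≤ 0 := by
  obtain ⟨F, hne, hF, hneg⟩ := P.exists_folner_sum_neg hG hf K hε
  have hc : (0 : ℝ) < F.card := by exact_mod_cast hne.card_pos
  have hact : ∀ g : G, Continuous fun x : X => g • x := fun g => continuous_const_smul g
  set B : κ → X → ℝ := fun i x => ∑ g ∈ F, f i (g • x) with hB
  have hBc : ∀ i, Continuous (B i) := fun i =>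
    continuous_finsetSum _ fun g _ => (f i).continuous.comp (hact g)
  -- Weighting by negative parts makes `h i` vanish wherever `B i ≥ 0`; the sum of the weights never
  -- vanishes because some `B i x` is negative at each `x`.
  set N : κ → X → ℝ := fun i x => max (-B i x) 0 with hN
  have hNc : ∀ i, Continuous (N i) := fun i => (hBc i).neg.max continuous_const
  have hN0 : ∀ i x, 0 ≤ N i x := fun i x => le_max_right _ _
  set S : X → ℝ := fun x => ∑ i, N i x with hS
  have hSc : Continuous S := continuous_finsetSum _ fun i _ => hNc i
  have hS0 : ∀ x, 0 < S x := fun x => by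
    obtain ⟨i, hi⟩ := hneg x
    exact Finset.sum_pos' (fun i _ => hN0 i x)
      ⟨i, Finset.mem_univ i, lt_max_of_lt_left (neg_pos.2 hi)⟩
  set h : κ → C(X, ℝ) := fun i =>
    ⟨fun x => N i x / S x, (hNc i).div hSc fun x => (hS0 x).ne'⟩ with hh
  have hh0 : ∀ i x, 0 ≤ h i x := fun i x => div_nonneg (hN0 i x) (hS0 x).le
  have hh1 : ∀ x, ∑ i, h i x = 1 := fun x => by
    change ∑ i, N i x / S x = 1
    rw [← Finset.sum_div, div_self (hS0 x).ne']
  have hhle : ∀ i x, h i x ≤ 1 := fun i x => by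
    rw [← hh1 x]
    exact Finset.single_le_sum (fun j _ => hh0 j x) (Finset.mem_univ i)
  set e : κ → C(X, ℝ) := fun i => ⟨fun x => (F.card : ℝ)⁻¹ * ∑ g ∈ F, h i (g⁻¹ • x),
    continuous_const.mul (continuous_finsetSum _ fun g _ => (h i).continuous.comp (hact _))⟩
    with he
  have he_apply : ∀ i x, e i x = (F.card : ℝ)⁻¹ * ∑ g ∈ F, h i (g⁻¹ • x) := fun _ _ => rfl
  refine ⟨e, fun i x => ?_, ?_, fun i k hk => ?_, fun τ hτ i => ?_⟩
  · exact mul_nonneg (by positivity) (Finset.sum_nonneg fun g _ => hh0 i _)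
  · ext x
    simp only [ContinuousMap.coe_sum, Finset.sum_apply, he_apply, ContinuousMap.one_apply]
    rw [← Finset.mul_sum, Finset.sum_comm]
    simp only [hh1]
    rw [Finset.sum_const, nsmul_eq_mul, mul_one, inv_mul_cancel₀ hc.ne']
  · refine (ContinuousMap.norm_le _ hε.le).2 fun x => ?_
    -- With inverses in the definition of `e`, translating by `k` replaces `s` by `k * s`, so the
    -- same left invariance of `F` serves here and for the sums `B`.
    have h1 := hF.norm_sum_translate_sub_le hk (φ := fun s => h i (s⁻¹ • x)) (M := 1) fun s => by
      rw [Real.norm_eq_abs, abs_of_nonneg (hh0 i _)]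
      exact hhle i _
    have h2 : (translateFun k (complexify (e i)) - complexify (e i)) x =
        ((F.card : ℝ)⁻¹ *
          (∑ s ∈ F, h i ((k * s)⁻¹ • x) - ∑ s ∈ F, h i (s⁻¹ • x)) : ℝ) := by
      simp only [ContinuousMap.sub_apply, translateFun, ContinuousMap.comp_apply,
        ContinuousMap.coe_mk, complexify_apply, he_apply, mul_inv_rev, mul_smul]
      push_cast
      ring
    rw [h2, Complex.norm_real, norm_mul, norm_inv, Real.norm_natCast, inv_mul_le_iff₀ hc]
    linarith
  -- Each summand is written as a translate. A trace does not see the translation, and the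
  -- untranslated summands add up to `B i * h i`.
  · have h1 : complexify (f i * e i) = (F.card : ℂ)⁻¹ •
        ∑ g ∈ F, translateFun g (translateFun g⁻¹ (complexify (f i)) * complexify (h i)) := by
      ext x
      simp only [complexify_apply, ContinuousMap.mul_apply, he_apply, ContinuousMap.smul_apply,
        ContinuousMap.coe_sum, Finset.sum_apply, translateFun, ContinuousMap.comp_apply,
        ContinuousMap.coe_mk, inv_inv, smul_inv_smul, smul_eq_mul, ← Finset.mul_sum]
      push_cast
      ring
    have h2 : ∑ g ∈ F, translateFun g⁻¹ (complexify (f i)) * complexify (h i) =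
        -complexify ⟨fun x => N i x ^ 2 / S x, ((hNc i).pow 2).div hSc fun x => (hS0 x).ne'⟩ := by
      ext x
      simp only [ContinuousMap.coe_sum, Finset.sum_apply, ContinuousMap.mul_apply,
        ContinuousMap.neg_apply, complexify_apply, translateFun, ContinuousMap.comp_apply,
        ContinuousMap.coe_mk, inv_inv, ← Finset.sum_mul]
      -- `N` is zero where `B ≥ 0` and equals `-B` elsewhere.
      have h3 : B i x * N i x = -N i x ^ 2 := by
        rcases le_total (-B i x) 0 with h | h
        · simp [hN, max_eq_right h]
        · simp only [hN, max_eq_left h]; ring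
      have h4 : B i x * (N i x / S x) = -(N i x ^ 2 / S x) := by
        rw [mul_div_assoc', h3, neg_div]
      exact_mod_cast h4
    have h3 : τ (P.fn (complexify (f i * e i))) = (F.card : ℂ)⁻¹ *
        -τ (P.fn (complexify
          ⟨fun x => N i x ^ 2 / S x, ((hNc i).pow 2).div hSc fun x => (hS0 x).ne'⟩)) := by
      rw [h1, map_smul, map_smul, smul_eq_mul, map_sum, map_sum]
      simp only [P.traceSpace_translateFun hτ]
      rw [← map_sum, ← map_sum, h2, map_neg, map_neg]
    rw [h3, ← Complex.ofReal_natCast, ← Complex.ofReal_inv, Complex.re_ofReal_mul, Complex.neg_re]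
    have h4 := P.fn_complexify_nonneg hτ
      (f := ⟨fun x => N i x ^ 2 / S x, ((hNc i).pow 2).div hSc fun x => (hS0 x).ne'⟩)
      fun x => div_nonneg (sq_nonneg _) (hS0 x).le
    have h5 : (0 : ℝ) ≤ (F.card : ℝ)⁻¹ := by positivity
    nlinarith

end RegularPair

end Folner

/-! ### Weak CPoU -/

section WeakCPoU

set_option linter.unusedSectionVars false

/-! ### Constant sequences and compressions of limit traces. -/

section Ultrapower

variable {A : Type*} [NonUnitalCStarAlgebra A]

/-- A bounded sequence from an explicit bound. -/
def mkBddSeq (f : ℕ → A) (M : ℝ) (h : ∀ n, ‖f n‖ ≤ M) : BddSeq A :=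
  ⟨f, memℓp_infty ⟨M, by rintro _ ⟨n, rfl⟩; exact h n⟩⟩

lemma norm_mkBddSeq_le (f : ℕ → A) {M : ℝ} (hM : 0 ≤ M) (h : ∀ n, ‖f n‖ ≤ M) :
    ‖mkBddSeq f M h‖ ≤ M :=
  lp.norm_le_of_forall_le hM h

variable {𝓤 : Ultrafilter ℕ}

lemma constUltrapower_mul (a b : A) :
    constUltrapower 𝓤 (a * b) = constUltrapower 𝓤 a * constUltrapower 𝓤 b := rfl

lemma constUltrapower_star (a : A) :
    constUltrapower 𝓤 (star a) = star (constUltrapower 𝓤 a) := rfl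

lemma map_toUltrapower_sub_smul (φ : TracialUltrapower A 𝓤 →ₗ[ℂ] ℂ) (x y : BddSeq A) (c : ℂ) :
    φ (toUltrapower 𝓤 (x - c • y)) = φ (toUltrapower 𝓤 x) - c * φ (toUltrapower 𝓤 y) := by
  change φ (toUltrapower 𝓤 x - c • toUltrapower 𝓤 y) = _
  rw [map_sub, map_smul, smul_eq_mul]

lemma constUltrapower_isUnit {e : A} (he : ∀ a, e * a = a ∧ a * e = a)
    (x : TracialUltrapower A 𝓤) :
    constUltrapower 𝓤 e * x = x ∧ x * constUltrapower 𝓤 e = x := by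
  obtain ⟨b, rfl⟩ := toUltrapower_surjective 𝓤 x
  constructor
  · exact congrArg (toUltrapower 𝓤) (lp.ext (funext fun n => (he (b n)).1))
  · exact congrArg (toUltrapower 𝓤) (lp.ext (funext fun n => (he (b n)).2))

/-- Compressing a limit trace by a central positive element gives a multiple of a trace. -/
lemma exists_traceSpace_of_central {e : A} (he : ∀ a, e * a = a ∧ a * e = a)
    {φ : TracialUltrapower A 𝓤 →ₗ[ℂ] ℂ} (hφ : φ ∈ limitTraces A 𝓤) {q : TracialUltrapower A 𝓤}
    (hq : IsStarPositive q) (hcomm : ∀ b, Commute q (constUltrapower 𝓤 b)) (hpos : 0 < (φ q).re) :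
    ∃ ψ ∈ traceSpace A, ∀ b, φ (constUltrapower 𝓤 b * q) = φ q * ψ b := by
  obtain ⟨y, hy⟩ := hq
  obtain ⟨ρ, hρ⟩ := toUltrapower_surjective 𝓤 q
  have hq0 : 0 ≤ φ q := hy ▸ limitTraces_nonneg hφ y
  have hqne : φ q ≠ 0 := fun h => by simp [h] at hpos
  let L : A →L[ℂ] ℂ := LinearMap.mkContinuous
    { toFun := fun b => φ (constUltrapower 𝓤 b * q)
      map_add' := fun a b => by
        rw [← map_add, ← add_mul]; rfl
      map_smul' := fun c b => by
        have h : constUltrapower 𝓤 (c • b) * q = c • (constUltrapower 𝓤 b * q) := by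
          rw [← hρ]
          exact congrArg (toUltrapower 𝓤)
            (lp.ext (funext fun n => smul_mul_assoc c b (ρ n)))
        rw [h, map_smul, RingHom.id_apply] }
    ‖ρ‖ fun b => by
      have h := norm_limitTraces_le hφ
        ((⟨fun _ => b, memℓp_infty ⟨‖b‖, by rintro _ ⟨_, rfl⟩; exact le_rfl⟩⟩ : BddSeq A) * ρ)
      rw [toUltrapower_mul, hρ] at h
      refine h.trans ((norm_mul_le _ _).trans ?_)
      rw [mul_comm]
      exact mul_le_mul_of_nonneg_left
        (lp.norm_le_of_forall_le (norm_nonneg _) fun _ => le_rfl) (norm_nonneg _)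
  have hL : ∀ b, L b = φ (constUltrapower 𝓤 b * q) := fun _ => rfl
  have hψ : ∀ b, ((φ q)⁻¹ • L) b = (φ q)⁻¹ * φ (constUltrapower 𝓤 b * q) := fun _ => rfl
  refine ⟨StrongDual.toWeakDual ((φ q)⁻¹ • L), (mem_traceSpace_iff he).2
    ⟨fun a => ?_, ?_, fun a b => ?_⟩, fun b => ?_⟩
  · refine (mul_nonneg (inv_nonneg.2 hq0) ?_).trans_eq (hψ _).symm
    -- Writing `q = y^* y` and moving it past `a` exhibits the product as a square, so no square
    -- root commuting with `A` is required.
    have h : constUltrapower 𝓤 (star a * a) * q =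
        star (y * constUltrapower 𝓤 a) * (y * constUltrapower 𝓤 a) := by
      rw [constUltrapower_mul, constUltrapower_star, mul_assoc, ← (hcomm a).eq, hy, star_mul]
      simp only [mul_assoc]
    rw [h]
    exact limitTraces_nonneg hφ _
  · refine (hψ e).trans ?_
    rw [(constUltrapower_isUnit he q).1, inv_mul_cancel₀ hqne]
  · refine (hψ _).trans (Eq.trans ?_ (hψ _).symm)
    rw [constUltrapower_mul, constUltrapower_mul, mul_assoc, ← (hcomm b).eq, ← mul_assoc,
      limitTraces_mul_comm hφ, mul_assoc]
  · change _ = φ q * ((φ q)⁻¹ • L) b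
    rw [hψ, mul_inv_cancel_left₀ hqne]

end Ultrapower

/-! ### Real representatives and the diagonal construction. -/

variable {G X : Type*} [Group G] [TopologicalSpace X] [CompactSpace X]
  [MulAction G X] [ContinuousConstSMul G X]

/-- The real part of a function. -/
def rePart {X : Type*} [TopologicalSpace X] (f : C(X, ℂ)) : C(X, ℝ) :=
  ⟨fun x => (f x).re, Complex.continuous_re.comp f.continuous⟩

lemma complexify_rePart {X : Type*} [TopologicalSpace X] (f : C(X, ℂ)) :
    complexify (rePart f) = (2⁻¹ : ℂ) • (f + star f) := by
  ext x
  simp only [complexify_apply, rePart, ContinuousMap.coe_mk, ContinuousMap.smul_apply,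
    ContinuousMap.add_apply, ContinuousMap.star_apply, Complex.star_def, smul_eq_mul,
    Complex.re_eq_add_conj]
  ring

lemma complexify_rePart_of_star_eq {X : Type*} [TopologicalSpace X] {f : C(X, ℂ)}
    (hf : star f = f) : complexify (rePart f) = f := by
  rw [complexify_rePart, hf, ← two_smul ℂ, smul_smul, inv_mul_cancel₀ two_ne_zero, one_smul]

namespace RegularPair

variable {A : Type*} [NonUnitalCStarAlgebra A] (P : RegularPair G X A)

lemma exists_norm_commutator_le_finset {ι : Type*} (J : Finset ι) (b : ι → A) {η : ℝ}
    (hη : 0 < η) :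
    ∃ (K : Finset G) (ε : ℝ), 0 < ε ∧ ∀ h : C(X, ℂ), ‖h‖ ≤ 1 →
      (∀ g ∈ K, ‖translateFun g h - h‖ ≤ ε) → ∀ j ∈ J, ‖P.fn h * b j - b j * P.fn h‖ ≤ η := by
  classical
  induction J using Finset.induction_on with
  | empty => exact ⟨∅, 1, one_pos, fun _ _ _ j hj => absurd hj (Finset.notMem_empty j)⟩
  | insert i J _ ih =>
    obtain ⟨K, ε, hε, h1⟩ := ih
    obtain ⟨L, ε', hε', h2⟩ := P.exists_norm_commutator_le (b i) hη
    refine ⟨K ∪ L, min ε ε', lt_min hε hε', fun h hh hK j hj => ?_⟩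
    rcases Finset.mem_insert.1 hj with rfl | hj
    · exact h2 h hh fun g hg => (hK g (Finset.mem_union_right _ hg)).trans (min_le_right _ _)
    · exact h1 h hh (fun g hg => (hK g (Finset.mem_union_left _ hg)).trans (min_le_left _ _)) j hj

lemma exists_real_of_star_eq {a : A} (ha : a ∈ NonUnitalStarAlgHom.range P.fn)
    (hs : star a = a) : ∃ f : C(X, ℝ), P.fn (complexify f) = a := by
  obtain ⟨f, rfl⟩ := ha
  exact ⟨rePart f, congrArg P.fn <| complexify_rePart_of_star_eq <|
    P.isometry_fn.injective ((map_star P.fn f).trans hs)⟩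

variable {𝓤 : Ultrafilter ℕ}

/-- Averaging a representative with its adjoint does not change a self-adjoint class. The functions
`r n` need not be nonnegative: positivity of `q` is used only through limit traces. -/
lemma exists_real_representative {q : TracialUltrapower A 𝓤}
    (hq : q ∈ subUltrapower 𝓤 (NonUnitalStarAlgHom.range P.fn)) (hs : star q = q) :
    ∃ (r : ℕ → C(X, ℝ)) (ρ : BddSeq A), (∀ n, ρ n = P.fn (complexify (r n))) ∧
      toUltrapower 𝓤 ρ = q := by
  obtain ⟨d, hd, rfl⟩ := hq
  choose f hf using hd
  refine ⟨fun n => rePart (f n), (2⁻¹ : ℂ) • (d + star d), fun n => ?_, ?_⟩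
  · rw [complexify_rePart, map_smul, map_add, map_star]
    change (2⁻¹ : ℂ) • (d n + star (d n)) = _
    rw [← hf n]
    rfl
  · change (2⁻¹ : ℂ) • (toUltrapower 𝓤 d + star (toUltrapower 𝓤 d)) = _
    rw [hs, ← two_smul ℂ, smul_smul, inv_mul_cancel₀ two_ne_zero, one_smul]

/-- If no trace is at least `δ` on all `a i`, then for most `n` no trace is nonnegative on all
`(a i - δ) q_n`, for a central positive `q` on which the limit traces do not vanish. -/
lemma eventually_exists_neg (hT : (traceSpace A).Nonempty) {κ : Type*} {a : κ → C(X, ℝ)} {δ : ℝ}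
    (ha : ∀ τ ∈ traceSpace A, ∃ i, (τ (P.fn (complexify (a i)))).re < δ)
    {r : ℕ → C(X, ℝ)} {ρ : BddSeq A} (hρ : ∀ n, ρ n = P.fn (complexify (r n)))
    (hpos : IsStarPositive (toUltrapower 𝓤 ρ))
    (hcomm : ∀ b, Commute (toUltrapower 𝓤 ρ) (constUltrapower 𝓤 b))
    (hfaith : ∀ φ ∈ limitTraces A 𝓤, 0 < (φ (toUltrapower 𝓤 ρ)).re) :
    ∀ᶠ n in 𝓤, ∀ τ ∈ traceSpace A, ∃ i,
      (τ (P.fn (complexify ((a i - ContinuousMap.const X δ) * r n)))).re < 0 := by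
  by_contra hc
  rw [← Ultrafilter.eventually_not] at hc
  obtain ⟨τ₀, hτ₀⟩ := hT
  have h1 : ∀ n, ∃ τ ∈ traceSpace A, (¬ ∀ τ ∈ traceSpace A, ∃ i,
      (τ (P.fn (complexify ((a i - ContinuousMap.const X δ) * r n)))).re < 0) →
      ∀ i, 0 ≤ (τ (P.fn (complexify ((a i - ContinuousMap.const X δ) * r n)))).re := by
    intro n
    by_cases hn : ∀ τ ∈ traceSpace A, ∃ i,
      (τ (P.fn (complexify ((a i - ContinuousMap.const X δ) * r n)))).re < 0
    · exact ⟨τ₀, hτ₀, fun h => absurd hn h⟩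
    · have hn' := hn
      push Not at hn'
      obtain ⟨τ, hτ, h⟩ := hn'
      exact ⟨τ, hτ, fun _ => h⟩
  choose τ hτ hτ2 using h1
  obtain ⟨φ, hφ, hlim⟩ := exists_limitTrace (𝓤 := 𝓤) P.fn_one_isUnit hτ
  -- For the trace `ψ = φ(· q) / φ(q)` some `ψ(a i) < δ`, so `φ((a i - δ) q) = φ(q) (ψ(a i) - δ) <
  -- 0`. This contradicts the nonnegativity of the traces `τ n` that converge to `φ`.
  obtain ⟨ψ, hψ, hψ2⟩ := exists_traceSpace_of_central P.fn_one_isUnit hφ hpos hcomm (hfaith φ hφ)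
  obtain ⟨i, hi⟩ := ha ψ hψ
  set c : BddSeq A := mkBddSeq (fun _ => P.fn (complexify (a i))) _ fun _ => le_rfl with hcdef
  have h2 : ∀ n, P.fn (complexify ((a i - ContinuousMap.const X δ) * r n)) =
      (c * ρ - (δ : ℂ) • ρ : BddSeq A) n := by
    intro n
    change _ = P.fn (complexify (a i)) * ρ n - (δ : ℂ) • ρ n
    rw [hρ, ← map_mul, ← map_smul, ← map_sub]
    congr 1
    ext x
    simp [complexify_apply, sub_mul]
  have h3 : 0 ≤ (φ (toUltrapower 𝓤 (c * ρ - (δ : ℂ) • ρ))).re := by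
    refine ge_of_tendsto ((Complex.continuous_re.tendsto _).comp (hlim _)) ?_
    filter_upwards [hc] with n hn
    have h4 := hτ2 n hn i
    rw [h2] at h4
    exact h4
  have h4 : φ (toUltrapower 𝓤 (c * ρ)) = φ (toUltrapower 𝓤 ρ) * ψ (P.fn (complexify (a i))) :=
    hψ2 _
  have h5 : 0 ≤ φ (toUltrapower 𝓤 ρ) := by
    obtain ⟨y, hy⟩ := hpos
    rw [hy]
    exact limitTraces_nonneg hφ y
  have h6 := (Complex.le_def.1 h5).2
  rw [Complex.zero_im] at h6
  rw [map_toUltrapower_sub_smul, h4, Complex.sub_re, Complex.re_ofReal_mul, Complex.mul_re,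
    ← h6] at h3
  nlinarith [hfaith φ hφ]

/-- The partition of unity for a single index: almost invariant, and subordinate to `f` provided
every trace is negative on some `f i`. -/
lemma exists_partition_commutator (hG : IsAmenableGroup G) {κ ι : Type*} [Fintype κ] [Nonempty κ]
    (f : κ → C(X, ℝ)) (J : Finset ι) (b : ι → A) {η : ℝ} (hη : 0 < η) :
    ∃ e : κ → C(X, ℝ), (∀ i, 0 ≤ e i) ∧ (∀ i x, e i x ≤ 1) ∧ ∑ i, e i = 1 ∧
      (∀ i, ∀ j ∈ J,
        ‖P.fn (complexify (e i)) * b j - b j * P.fn (complexify (e i))‖ ≤ η) ∧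
      ((∀ τ ∈ traceSpace A, ∃ i, (τ (P.fn (complexify (f i)))).re < 0) →
        ∀ τ ∈ traceSpace A, ∀ i, (τ (P.fn (complexify (f i * e i)))).re ≤ 0) := by
  obtain ⟨K, ε, hε, hK⟩ := P.exists_norm_commutator_le_finset J b hη
  have key : ∀ f : κ → C(X, ℝ),
      (∀ τ ∈ traceSpace A, ∃ i, (τ (P.fn (complexify (f i)))).re < 0) →
      ∃ e : κ → C(X, ℝ), (∀ i, 0 ≤ e i) ∧ (∀ i x, e i x ≤ 1) ∧ ∑ i, e i = 1 ∧
      (∀ i, ∀ j ∈ J,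
        ‖P.fn (complexify (e i)) * b j - b j * P.fn (complexify (e i))‖ ≤ η) ∧
      ∀ τ ∈ traceSpace A, ∀ i, (τ (P.fn (complexify (f i * e i)))).re ≤ 0 := by
    intro f hf
    obtain ⟨e, he0, he1, heK, heτ⟩ := P.exists_partition hG hf K hε
    have hle : ∀ i x, e i x ≤ 1 := fun i x => by
      have h := congrArg (fun f : C(X, ℝ) => f x) he1
      simp only [ContinuousMap.coe_sum, Finset.sum_apply, ContinuousMap.one_apply] at h
      rw [← h]
      exact Finset.single_le_sum (fun j _ => he0 j x) (Finset.mem_univ i)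
    refine ⟨e, he0, hle, he1, fun i => hK _ (norm_complexify_le zero_le_one fun x =>
      (abs_of_nonneg (show (0 : ℝ) ≤ e i x from he0 i x)).trans_le (hle i x)) (heK i), heτ⟩
  by_cases hf : ∀ τ ∈ traceSpace A, ∃ i, (τ (P.fn (complexify (f i)))).re < 0
  · obtain ⟨e, h1, h2, h3, h4, h5⟩ := key f hf
    exact ⟨e, h1, h2, h3, h4, fun _ => h5⟩
  -- A partition is needed at every index, including the `𝓤`-negligible ones where the negativity
  -- hypothesis fails; the constant `-1` always satisfies it.
  · obtain ⟨e, h1, h2, h3, h4, _⟩ := key (fun _ => -1) fun τ hτ => by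
      refine ⟨Classical.arbitrary κ, ?_⟩
      have h : complexify (-1 : C(X, ℝ)) = -1 := by ext x; simp [complexify_apply]
      rw [h, map_neg, map_neg, ((mem_traceSpace_iff P.fn_one_isUnit).1 hτ).2.1]
      simp
    exact ⟨e, h1, h2, h3, h4, fun h => absurd h hf⟩

/-- The partition at index `n` handles the functions `(a i - δ) r n` and almost commutes with the
`n`-th entries of the first `n + 1` members of a countable family dense in `S`. -/
theorem hasWeakCPoU [Countable G] [TopologicalSpace.SeparableSpace C(X, ℂ)] [Nonempty X]
    (hG : IsAmenableGroup G) (h𝓤 : (𝓤 : Filter ℕ) ≤ cofinite) :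
    HasWeakCPoU (A := A) 𝓤 (NonUnitalStarAlgHom.range P.fn) where
  isClosed := P.isClosed_range
  ne_bot := P.range_ne_bot
  separable := P.separableSpace
  nonempty_traceSpace := P.traceSpace_nonempty hG
  isCompact_traceSpace := isCompact_traceSpace_of_unit P.fn_one_isUnit
  exists_partition := by
    have hT := P.traceSpace_nonempty hG
    refine ⟨constUltrapower 𝓤 (P.fn 1), ⟨_, fun n => ⟨1, rfl⟩, rfl⟩,
      constUltrapower_isUnit P.fn_one_isUnit, ?_⟩
    rintro S ⟨C, hCS, hCc, hCd⟩ k hk a ha δ hδ hsup q hq hqpos hqcomm hqfaith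
    have : Nonempty (Fin k) := ⟨⟨0, hk⟩⟩
    have hreal : ∀ i, ∃ f : C(X, ℝ), P.fn (complexify f) = a i := fun i => by
      obtain ⟨y, hy⟩ := (ha i).2
      exact P.exists_real_of_star_eq (ha i).1 (by rw [hy, star_mul, star_star])
    choose A₀ hA₀ using hreal
    have hneg : ∀ τ ∈ traceSpace A, ∃ i, (τ (P.fn (complexify (A₀ i)))).re < δ := by
      intro τ hτ
      have hbdd : BddAbove (Set.range fun τ : traceSpace A =>
          ⨅ i, ((τ : WeakDual ℂ A) (a i)).re) := by
        refine ⟨‖a ⟨0, hk⟩‖, ?_⟩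
        rintro _ ⟨⟨σ, hσ⟩, rfl⟩
        exact (ciInf_le (Set.finite_range _).bddBelow ⟨0, hk⟩).trans
          ((Complex.re_le_norm _).trans (norm_apply_le_of_mem_traceSpace hσ _))
      obtain ⟨i, hi⟩ := exists_lt_of_ciInf_lt ((le_ciSup hbdd ⟨τ, hτ⟩).trans_lt hsup)
      exact ⟨i, by rw [hA₀]; exact hi⟩
    have hqs : star q = q := by
      obtain ⟨y, hy⟩ := hqpos.1
      rw [hy, star_mul, star_star]
    obtain ⟨r, ρ, hρ, rfl⟩ := P.exists_real_representative hq hqs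
    obtain ⟨s, hs⟩ := Set.countable_iff_exists_subset_range.1 hCc
    choose b hb using fun j => toUltrapower_surjective 𝓤 (s j)
    choose e he0 hele he1 hecomm heτ using fun n : ℕ => P.exists_partition_commutator hG
      (fun i => (A₀ i - ContinuousMap.const X δ) * r n) (Finset.range (n + 1)) (fun j => b j n)
      (Nat.one_div_pos_of_nat (α := ℝ) (n := n))
    have hnorm : ∀ i n, ‖P.fn (complexify (e n i))‖ ≤ 1 := fun i n =>
      (P.norm_fn_le _).trans (norm_complexify_le zero_le_one fun x =>
        (abs_of_nonneg (show (0 : ℝ) ≤ e n i x from he0 n i x)).trans_le (hele n i x))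
    -- The pointwise square roots form the bounded sequence that witnesses positivity of the classes
    -- of `E i`.
    have hsqrt : ∀ i n, ‖P.fn (complexify (sqrtFun (e n i)))‖ ≤ 1 := fun i n =>
      (P.norm_fn_le _).trans (norm_complexify_le zero_le_one fun x => by
        change |Real.sqrt (e n i x)| ≤ 1
        rw [abs_of_nonneg (Real.sqrt_nonneg _)]
        exact Real.sqrt_le_one.2 (hele n i x))
    set E : Fin k → BddSeq A := fun i => mkBddSeq _ 1 (hnorm i) with hE
    refine ⟨fun i => toUltrapower 𝓤 (E i), fun i => ⟨⟨E i, fun n => ⟨_, rfl⟩, rfl⟩,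
      ⟨⟨toUltrapower 𝓤 (mkBddSeq _ 1 (hsqrt i)), ?_⟩, ?_⟩, fun x hx => ?_⟩, ?_, ?_⟩
    · refine congrArg (toUltrapower 𝓤) (lp.ext (funext fun n => ?_))
      change P.fn (complexify (e n i)) = star (P.fn _) * P.fn _
      rw [complexify_eq_star_mul_self (he0 n i), map_mul, map_star]
    · exact (Submodule.Quotient.norm_mk_le _ _).trans (norm_mkBddSeq_le _ zero_le_one (hnorm i))
    · refine commute_of_tendsto_commutator P.fn_one_isUnit hT
        (norm_mkBddSeq_le _ zero_le_one (hnorm i)) fun ε hε => ?_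
      obtain ⟨c, hc, hxc⟩ := hCd x hx ε hε
      obtain ⟨j, rfl⟩ := hs hc
      refine ⟨b j, by rwa [hb], ?_⟩
      -- Freeness of `𝓤` enters only here: the tolerance `1 / (n + 1)` must tend to zero, and the
      -- `j`-th member is controlled only from `n = j` on.
      have hat : (𝓤 : Filter ℕ) ≤ atTop := by rwa [← Nat.cofinite_eq_atTop]
      refine squeeze_zero' (Eventually.of_forall fun _ => norm_nonneg _) ?_
        ((tendsto_one_div_add_atTop_nhds_zero_nat (𝕜 := ℝ)).mono_left hat)
      filter_upwards [hat (eventually_ge_atTop j)] with n hn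
      exact hecomm n i j (Finset.mem_range.2 (Nat.lt_succ_of_le hn))
    · have h1 : ∑ i, toUltrapower 𝓤 (E i) = toUltrapower 𝓤 (∑ i, E i) :=
        (map_sum (traceKernel A 𝓤).mkQ _ _).symm
      rw [h1]
      refine congrArg (toUltrapower 𝓤) (lp.ext (funext fun n => ?_))
      rw [lp.coeFn_sum, Finset.sum_apply]
      change ∑ i, P.fn (complexify (e n i)) = P.fn 1
      rw [← map_sum]
      congr 1
      ext x
      have h := congrArg (fun f : C(X, ℝ) => ((f x : ℝ) : ℂ)) (he1 n)
      simpa [complexify_apply] using h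
    · intro φ hφ i
      have hgood := P.eventually_exists_neg hT hneg hρ hqpos.1 hqcomm hqfaith
      obtain ⟨τ, hτ, hlim⟩ := hφ
      set c : BddSeq A := mkBddSeq (fun _ => a i) _ fun _ => le_rfl with hcdef
      -- All entries lie in the commutative algebra `C(X)`, so the product can be rearranged into
      -- representatives of `a i e_i q - δ e_i q`.
      have h2 : ∀ n, P.fn (complexify ((A₀ i - ContinuousMap.const X δ) * r n * e n i)) =
          (c * E i * ρ - (δ : ℂ) • (E i * ρ) : BddSeq A) n := by
        intro n
        change _ = a i * P.fn (complexify (e n i)) * ρ n -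
          (δ : ℂ) • (P.fn (complexify (e n i)) * ρ n)
        rw [hρ, ← hA₀, ← map_mul, ← map_mul, ← map_mul, ← map_smul, ← map_sub]
        congr 1
        ext x
        simp only [complexify_apply, ContinuousMap.mul_apply, ContinuousMap.sub_apply,
          ContinuousMap.smul_apply, ContinuousMap.const_apply, smul_eq_mul]
        push_cast
        ring
      have h3 : (φ (toUltrapower 𝓤 (c * E i * ρ - (δ : ℂ) • (E i * ρ)))).re ≤ 0 := by
        refine le_of_tendsto ((Complex.continuous_re.tendsto _).comp (hlim _)) ?_
        filter_upwards [hgood] with n hn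
        have h4 := heτ n hn (τ n) (hτ n) i
        rw [h2] at h4
        exact h4
      rw [map_toUltrapower_sub_smul, Complex.sub_re, Complex.re_ofReal_mul] at h3
      exact sub_nonpos.1 h3

end RegularPair

end WeakCPoU

end

/-- Metrizability of `X` enters only through the separability of `C(X)`. -/
theorem theorem5p1 {G : Type*} {X : Type*} [Group G] [Countable G]
    [MetricSpace X] [CompactSpace X] [Nonempty X]
    [MulAction G X] [ContinuousConstSMul G X] (hG : IsAmenableGroup G)
    (𝓤 : Ultrafilter ℕ) (h𝓤 : (𝓤 : Filter ℕ) ≤ cofinite) :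
    HasWeakCPoU (A := CrossedProduct G X) 𝓤 (crossedProductDiagonal G X) :=
  (crossedProductRegularPair G X).hasWeakCPoU hG h𝓤
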